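/- Let $G$ be a connected (real, finite-dimensional, $C^\infty$) Lie group with identity $e$ and Lie algebra $\mathfrak g$, whose elements are identified with the right invariant vector fields on $G$. Let $\mathcal X$ be a linear vector field on $G$, that is, a $C^\infty$ vector field with $\mathcal X(e)=0$ such that $[\mathcal X,Y]$ is right invariant for every right invariant vector field $Y$, and let $\mathcal D:\mathfrak g\to\mathfrak g$, $\mathcal D Y=-[\mathcal X,Y](e)$, be its associated derivation. Let $X_1,\dots,X_m$ be right invariant vector fields on $G$, let $\Omega\subset\mathbb R^m$ with $0\in\operatorname{int}\Omega$, and let $\mathcal U\subset L^\infty(\mathbb R,\Omega)$ be a class of controls that contains the zero control and is closed under time shifts and under concatenation (for instance $\mathcal U=L^\infty(\mathbb R,\Omega)$). Consider the linear system $$\dot g(t)=\mathcal X(g(t))+\sum_{j=1}^m u_j(t)X_j(g(t)),\qquad u=(u_1,\dots,u_m)\in\mathcal U,$$ and let $\mathcal A=\bigcup_{\tau>0}\mathcal A_\tau$ be its reachable set from $e$, where $\mathcal A_\tau$ is the set of the values at time $\tau$ of the solutions starting at $e$ at time $0$, for all controls $u\in\mathcal U$. Assume that $\mathcal A$ is open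 in $G$. Let $\mathfrak h$ be a Lie subalgebra of $\mathfrak g$ and let $\mathfrak n$ be an ideal of $\mathfrak h$ such that $\mathcal D(\mathfrak h)\subset\mathfrak n$. Let $H$ and $N$ be the connected Lie subgroups of $G$ with Lie algebras $\mathfrak h$ and $\mathfrak n$, respectively. If $N\subset\mathcal A$, then $H\subset\mathcal A$. -/

import Mathlib

open Set MeasureTheory
open scoped Manifold ContDiff

noncomputable section

/-- Over `ℝ`, the smoothness that Mathlib asks for to form the Lie algebra of a Lie group is finite,
so that `C^∞` Lie groups have a Lie algebra. -/
instance LieControl.leInfty_minSmoothness_three : ENat.LEInfty (minSmoothness ℝ 3) :=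
  ⟨by rw [minSmoothness_of_isRCLikeNormedField]; exact ENat.LEInfty.out⟩

namespace LieControl

section Fields

variable {E : Type*} [NormedAddCommGroup E] [NormedSpace ℝ E]
  {G : Type*} [TopologicalSpace G] [ChartedSpace E G] [Group G]

/-- The right invariant vector field on `G` whose value at the identity is `v`. -/
def rightInvariantField (v : GroupLieAlgebra 𝓘(ℝ, E) G) (g : G) : TangentSpace 𝓘(ℝ, E) g :=
  (mfderiv 𝓘(ℝ, E) 𝓘(ℝ, E) (fun x : G => x * g) (1 : G) v : TangentSpace 𝓘(ℝ, E) ((1 : G) * g))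

/-- A linear vector field on `G`: a `C^∞` vector field which vanishes at the identity and normalizes
the space of right invariant vector fields. -/
structure IsLinearVectorField [IsManifold 𝓘(ℝ, E) ∞ G]
    (X : (g : G) → TangentSpace 𝓘(ℝ, E) g) : Prop where
  smooth : ContMDiff 𝓘(ℝ, E) 𝓘(ℝ, E).tangent ∞
    (fun g => (⟨g, X g⟩ : TangentBundle 𝓘(ℝ, E) G))
  normalizes : ∀ v : GroupLieAlgebra 𝓘(ℝ, E) G, ∃ w : GroupLieAlgebra 𝓘(ℝ, E) G,
    VectorField.mlieBracket 𝓘(ℝ, E) X (rightInvariantField v) = rightInvariantField w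
  map_one : X 1 = 0

/-- The derivation `𝒟 Y = -[X, Y](e)` of the Lie algebra associated with a linear vector field `X`,
where an element of the Lie algebra is identified with the right invariant vector field that
it generates. -/
def assocDerivation (X : (g : G) → TangentSpace 𝓘(ℝ, E) g)
    (v : GroupLieAlgebra 𝓘(ℝ, E) G) : GroupLieAlgebra 𝓘(ℝ, E) G :=
  -VectorField.mlieBracket 𝓘(ℝ, E) X (rightInvariantField v) (1 : G)

/-- `γ : [0, T] → G` is a Carathéodory solution of
`γ'(t) = X(γ(t)) + ∑ j, u_j(t) X_j(γ(t))`, where `X_j` is the right invariant vector field generated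
by `B j`: it is continuous, absolutely continuous in charts, and satisfies the equation at almost
every time. The values of `γ` outside of `[0, T]` are irrelevant. -/
structure IsSolutionOn {m : ℕ} (X : (g : G) → TangentSpace 𝓘(ℝ, E) g)
    (B : Fin m → GroupLieAlgebra 𝓘(ℝ, E) G) (u : ℝ → Fin m → ℝ) (T : ℝ) (γ : ℝ → G) : Prop where
  continuousOn : ContinuousOn γ (Icc 0 T)
  absolutelyContinuous : ∀ (x : G) (a b : ℝ), 0 ≤ a → a ≤ b → b ≤ T →
    MapsTo γ (Icc a b) (chartAt E x).source →
      AbsolutelyContinuousOnInterval (fun t => chartAt E x (γ t)) a b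
  ae_hasMFDerivAt : ∀ᵐ t : ℝ, t ∈ Ioo 0 T →
    HasMFDerivAt 𝓘(ℝ, ℝ) 𝓘(ℝ, E) γ t
      ((1 : ℝ →L[ℝ] ℝ).smulRight (X (γ t) + ∑ j, u t j • rightInvariantField (B j) (γ t)))

/-- The points reachable from `g` at time `T` with controls in the class `U`. -/
def reachableAt {m : ℕ} (X : (g : G) → TangentSpace 𝓘(ℝ, E) g)
    (B : Fin m → GroupLieAlgebra 𝓘(ℝ, E) G) (U : Set (ℝ → Fin m → ℝ)) (T : ℝ) (g : G) : Set G :=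
  {h | ∃ u ∈ U, ∃ γ : ℝ → G, IsSolutionOn X B u T γ ∧ γ 0 = g ∧ γ T = h}

/-- The points reachable from `g` at some positive time with controls in the class `U`. -/
def reachableSet {m : ℕ} (X : (g : G) → TangentSpace 𝓘(ℝ, E) g)
    (B : Fin m → GroupLieAlgebra 𝓘(ℝ, E) G) (U : Set (ℝ → Fin m → ℝ)) (g : G) : Set G :=
  ⋃ T ∈ Ioi (0 : ℝ), reachableAt X B U T g

/-- `H` is a connected Lie subgroup of `G` (not necessarily closed) with Lie algebra `𝔥`: it carries
a topology and a smooth structure of its own for which it is a connected Lie group, the inclusion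
into `G` is a smooth immersion, and the image of the derivative of the inclusion at the identity
is `𝔥`. The topology of `H` need not be the subspace topology. -/
def IsConnectedLieSubgroup (𝔥 : Submodule ℝ (GroupLieAlgebra 𝓘(ℝ, E) G)) (H : Subgroup G) : Prop :=
  ∃ (k : ℕ) (_ : TopologicalSpace H) (_ : ChartedSpace (EuclideanSpace ℝ (Fin k)) H),
    LieGroup (𝓡 k) ∞ H ∧ ConnectedSpace H ∧
    ContMDiff (𝓡 k) 𝓘(ℝ, E) ∞ (fun x : H => (x : G)) ∧
    (∀ x : H, Function.Injective (mfderiv (𝓡 k) 𝓘(ℝ, E) (fun x : H => (x : G)) x)) ∧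
    ∀ v : GroupLieAlgebra 𝓘(ℝ, E) G,
      v ∈ 𝔥 ↔ ∃ w : TangentSpace (𝓡 k) (1 : H),
        mfderiv (𝓡 k) 𝓘(ℝ, E) (fun x : H => (x : G)) (1 : H) w = v

end Fields

/-- `U` is a class of admissible controls with values in `Ω ⊆ ℝ^m`: a set of functions in
`L^∞(ℝ, Ω)` that contains the zero control and is stable under time shifts and concatenation. As
elements of `L^∞` are only defined up to null sets, the values of a concatenation at the end points
of the two intervals are left free. -/
structure IsControlClass {m : ℕ} (Ω : Set (Fin m → ℝ)) (U : Set (ℝ → Fin m → ℝ)) : Prop where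
  memLp : ∀ u ∈ U, MemLp u ⊤ (volume : Measure ℝ)
  ae_mem : ∀ u ∈ U, ∀ᵐ t : ℝ, u t ∈ Ω
  zero_mem : (fun _ => 0) ∈ U
  shift_mem : ∀ u ∈ U, ∀ s : ℝ, (fun t => u (t + s)) ∈ U
  concat_mem : ∀ u₁ ∈ U, ∀ u₂ ∈ U, ∀ s t : ℝ, 0 < s → 0 < t → ∃ u ∈ U,
    (∀ τ ∈ Ioo 0 s, u τ = u₁ τ) ∧ ∀ τ ∈ Ioo s (s + t), u τ = u₂ (τ - s)

end LieControl

end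

/-!
Write `Φ g` for the left reading of the linear vector field `X`: the tangent vector `X g`, moved to
the identity by the left translation by `g⁻¹`. As left and right invariant vector fields commute
(`mlieBracket_left_right`), the condition that `X` normalizes the right invariant vector fields
yields the cocycle identity `X (a * b) = d(· * b) (X a) + d(a * ·) (X b)`
(`IsLinearVectorField.map_mul`), and from it the derivative of `Φ` along a curve with left velocity
`y`, namely `Φ' = 𝒟 y + ⁅Φ, y⁆` (`hasDerivWithinAt_leftReading`). This equation is used twice.

* Modulo the ideal `𝔫`, along curves of `H`, it is homogeneous and linear in `Φ`, and `Φ 1 = 0`;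
  so `Φ` takes values in `𝔫` on `H` (`leftReading_mem`).
* For `g` with `Φ g ∈ 𝔫`, the solution `y` of `y' = 𝒟 y`, `y = Φ g` at the final time, stays in `𝔫`,
  and the curve through `g` with left velocity `y` stays in the coset `g N`. Along this curve `y` and
  `Φ` satisfy the same linear equation, so that the curve is an integral curve of `X`
  (`exists_integralCurve_coset`). It exists for all times, as curves in a Lie group with prescribed
  left velocity do (`exists_hasLeftVelocityOn_Icc`).

By the cocycle identity, a trajectory of the system multiplied from the right by an integral curve
of `X` is again a trajectory, for the same control (`IsSolutionOn.mul_integralCurve`). Hence, if the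
integral curve through `g` is in the reachable set `𝒜` at all negative times, then `𝒜 g ⊆ 𝒜`: to
reach `a * g`, where `a` is reached at time `T`, steer first to the point at time `-T` of that curve,
and follow then the product of the trajectory to `a` with the curve (`mul_mem_reachableSet`). This
applies to every `n ∈ N`, whose integral curve stays in `N ⊆ 𝒜`, so that `𝒜 N ⊆ 𝒜`; and then
to every `h ∈ H ∩ 𝒜`, whose integral curve stays in `h N ⊆ 𝒜 N ⊆ 𝒜`. So the preimage of `𝒜` in `H`
is an open submonoid of `H`, for the own topology of `H`, and it is `H` by connectedness
(`range_subset_reachableSet`).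
-/

noncomputable section

set_option linter.unusedSectionVars false

namespace LieControl

/-! ### Translations and the Maurer–Cartan form -/

section Translations

variable {E : Type*} [NormedAddCommGroup E] [NormedSpace ℝ E]
  {G : Type*} [TopologicalSpace G] [ChartedSpace E G] [Group G] [LieGroup 𝓘(ℝ, E) ∞ G]

lemma mdifferentiableAt_mul_left (g h : G) :
    MDifferentiableAt 𝓘(ℝ, E) 𝓘(ℝ, E) (fun x : G => g * x) h :=
  (contMDiff_mul_left (I := 𝓘(ℝ, E)) (n := ∞) (a := g)).mdifferentiableAt (by simp)

lemma mdifferentiableAt_mul_right (g h : G) :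
    MDifferentiableAt 𝓘(ℝ, E) 𝓘(ℝ, E) (fun x : G => x * g) h :=
  (contMDiff_mul_right (I := 𝓘(ℝ, E)) (n := ∞) (a := g)).mdifferentiableAt (by simp)

/-- Left translations commute with each other's action on tangent vectors. -/
lemma mfderiv_mul_left_mul_left (a b g : G) (w : TangentSpace 𝓘(ℝ, E) g) :
    (mfderiv 𝓘(ℝ, E) 𝓘(ℝ, E) (fun x : G => a * x) (b * g)
      (mfderiv 𝓘(ℝ, E) 𝓘(ℝ, E) (fun x : G => b * x) g w) : E) =
    mfderiv 𝓘(ℝ, E) 𝓘(ℝ, E) (fun x : G => (a * b) * x) g w := by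
  have h := mfderiv_comp_apply (I := 𝓘(ℝ, E)) (I' := 𝓘(ℝ, E)) (I'' := 𝓘(ℝ, E)) g
    (mdifferentiableAt_mul_left a (b * g)) (mdifferentiableAt_mul_left b g) w
  rw [← h]
  have : (fun x : G => a * x) ∘ (fun x : G => b * x) = fun x : G => (a * b) * x := by
    ext x; simp [mul_assoc]
  rw [this]

lemma mfderiv_mul_right_mul_right (a b g : G) (w : TangentSpace 𝓘(ℝ, E) g) :
    (mfderiv 𝓘(ℝ, E) 𝓘(ℝ, E) (fun x : G => x * b) (g * a)
      (mfderiv 𝓘(ℝ, E) 𝓘(ℝ, E) (fun x : G => x * a) g w) : E) =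
    mfderiv 𝓘(ℝ, E) 𝓘(ℝ, E) (fun x : G => x * (a * b)) g w := by
  have h := mfderiv_comp_apply (I := 𝓘(ℝ, E)) (I' := 𝓘(ℝ, E)) (I'' := 𝓘(ℝ, E)) g
    (mdifferentiableAt_mul_right b (g * a)) (mdifferentiableAt_mul_right a g) w
  rw [← h]
  have : (fun x : G => x * b) ∘ (fun x : G => x * a) = fun x : G => x * (a * b) := by
    ext x; simp [mul_assoc]
  rw [this]

lemma mfderiv_mul_left_mul_right (a b g : G) (w : TangentSpace 𝓘(ℝ, E) g) :
    (mfderiv 𝓘(ℝ, E) 𝓘(ℝ, E) (fun x : G => a * x) (g * b)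
      (mfderiv 𝓘(ℝ, E) 𝓘(ℝ, E) (fun x : G => x * b) g w) : E) =
    mfderiv 𝓘(ℝ, E) 𝓘(ℝ, E) (fun x : G => x * b) (a * g)
      (mfderiv 𝓘(ℝ, E) 𝓘(ℝ, E) (fun x : G => a * x) g w) := by
  have h := mfderiv_comp_apply (I := 𝓘(ℝ, E)) (I' := 𝓘(ℝ, E)) (I'' := 𝓘(ℝ, E)) g
    (mdifferentiableAt_mul_left a (g * b)) (mdifferentiableAt_mul_right b g) w
  have h' := mfderiv_comp_apply (I := 𝓘(ℝ, E)) (I' := 𝓘(ℝ, E)) (I'' := 𝓘(ℝ, E)) g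
    (mdifferentiableAt_mul_right b (a * g)) (mdifferentiableAt_mul_left a g) w
  rw [← h, ← h']
  have : (fun x : G => a * x) ∘ (fun x : G => x * b) =
      (fun x : G => x * b) ∘ (fun x : G => a * x) := by
    ext x; simp [mul_assoc]
  rw [this]

lemma mfderiv_one_mul (g : G) (w : TangentSpace 𝓘(ℝ, E) g) :
    (mfderiv 𝓘(ℝ, E) 𝓘(ℝ, E) (fun x : G => 1 * x) g w : E) = w := by
  have : (fun x : G => 1 * x) = id := by ext x; simp
  rw [this, mfderiv_id]; rfl

lemma mfderiv_mul_one (g : G) (w : TangentSpace 𝓘(ℝ, E) g) :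
    (mfderiv 𝓘(ℝ, E) 𝓘(ℝ, E) (fun x : G => x * 1) g w : E) = w := by
  have : (fun x : G => x * 1) = id := by ext x; simp
  rw [this, mfderiv_id]; rfl

/-- Two points that agree give the same derivative of a left translation; tangent vectors are
regarded as elements of the model space. -/
lemma mfderiv_mul_left_congr {a a' g g' : G} (ha : a = a') (hg : g = g') (w : E) :
    (mfderiv 𝓘(ℝ, E) 𝓘(ℝ, E) (fun x : G => a * x) g (w : TangentSpace 𝓘(ℝ, E) g) : E) =
    mfderiv 𝓘(ℝ, E) 𝓘(ℝ, E) (fun x : G => a' * x) g' (w : TangentSpace 𝓘(ℝ, E) g') := by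
  subst ha hg; rfl

lemma mfderiv_mul_right_congr {a a' g g' : G} (ha : a = a') (hg : g = g') (w : E) :
    (mfderiv 𝓘(ℝ, E) 𝓘(ℝ, E) (fun x : G => x * a) g (w : TangentSpace 𝓘(ℝ, E) g) : E) =
    mfderiv 𝓘(ℝ, E) 𝓘(ℝ, E) (fun x : G => x * a') g' (w : TangentSpace 𝓘(ℝ, E) g') := by
  subst ha hg; rfl

lemma mfderiv_mul_left_mulInvariantVectorField (g h : G) (v : GroupLieAlgebra 𝓘(ℝ, E) G) :
    mfderiv 𝓘(ℝ, E) 𝓘(ℝ, E) (fun x : G => g * x) h (mulInvariantVectorField v h) =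
      mulInvariantVectorField v (g * h) := by
  have := mfderiv_mul_left_mul_left (E := E) g h 1 v
  unfold mulInvariantVectorField
  rw [← this]
  exact mfderiv_mul_left_congr rfl (by simp) _

lemma mfderiv_mul_right_rightInvariantField (g h : G) (v : GroupLieAlgebra 𝓘(ℝ, E) G) :
    mfderiv 𝓘(ℝ, E) 𝓘(ℝ, E) (fun x : G => x * g) h (rightInvariantField v h) =
      rightInvariantField v (h * g) := by
  have := mfderiv_mul_right_mul_right (E := E) h g 1 v
  unfold rightInvariantField
  rw [← this]
  exact mfderiv_mul_right_congr rfl (by simp) _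

/-- The left Maurer–Cartan form: the tangent vector `w` at `g` is moved to the identity
by the left translation by `g⁻¹`. -/
def maurerCartan (g : G) : TangentSpace 𝓘(ℝ, E) g →L[ℝ] GroupLieAlgebra 𝓘(ℝ, E) G :=
  (mfderiv 𝓘(ℝ, E) 𝓘(ℝ, E) (fun x : G => g⁻¹ * x) g :
    TangentSpace 𝓘(ℝ, E) g →L[ℝ] TangentSpace 𝓘(ℝ, E) (g⁻¹ * g))

lemma mulInvariantVectorField_maurerCartan (g : G) (w : TangentSpace 𝓘(ℝ, E) g) :
    mulInvariantVectorField (maurerCartan g w) g = w := by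
  have := mfderiv_mul_left_mul_left (E := E) g g⁻¹ g w
  have h' := this.trans ((mfderiv_mul_left_congr (E := E) (mul_inv_cancel g) rfl w).trans
    (mfderiv_one_mul (E := E) g w))
  exact (mfderiv_mul_left_congr (E := E) rfl (inv_mul_cancel g).symm _).trans h'

lemma maurerCartan_mulInvariantVectorField (g : G) (v : GroupLieAlgebra 𝓘(ℝ, E) G) :
    maurerCartan g (mulInvariantVectorField v g) = v := by
  have := mfderiv_mul_left_mul_left (E := E) g⁻¹ g 1 v
  have h' := this.trans ((mfderiv_mul_left_congr (E := E) (inv_mul_cancel g) rfl v).trans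
    (mfderiv_one_mul (E := E) (1 : G) v))
  exact (mfderiv_mul_left_congr (E := E) rfl (mul_one g).symm _).trans h'

lemma maurerCartan_one (w : GroupLieAlgebra 𝓘(ℝ, E) G) : maurerCartan (1 : G) w = w := by
  have := mfderiv_one_mul (E := E) (1 : G) w
  unfold maurerCartan
  refine Eq.trans ?_ this
  exact mfderiv_mul_left_congr (by simp) rfl _

lemma mulInvariantVectorField_one (v : GroupLieAlgebra 𝓘(ℝ, E) G) :
    mulInvariantVectorField v (1 : G) = v := mfderiv_one_mul (E := E) (1 : G) v

lemma rightInvariantField_one (v : GroupLieAlgebra 𝓘(ℝ, E) G) :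
    rightInvariantField v (1 : G) = v := mfderiv_mul_one (E := E) (1 : G) v

/-- The left invariant vector field generated by `v` depends linearly on `v`. -/
def leftInvariantCLM (g : G) : GroupLieAlgebra 𝓘(ℝ, E) G →L[ℝ] TangentSpace 𝓘(ℝ, E) g :=
  (mfderiv 𝓘(ℝ, E) 𝓘(ℝ, E) (fun x : G => g * x) (1 : G) :
    GroupLieAlgebra 𝓘(ℝ, E) G →L[ℝ] TangentSpace 𝓘(ℝ, E) (g * 1))

lemma leftInvariantCLM_apply (g : G) (v : GroupLieAlgebra 𝓘(ℝ, E) G) :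
    leftInvariantCLM g v = mulInvariantVectorField v g := rfl

/-- Differentiating a product of curves. -/
lemma HasMFDerivWithinAt.curve_mul {a b : ℝ → G} {s : Set ℝ} {t : ℝ}
    {a' : TangentSpace 𝓘(ℝ, E) (a t)} {b' : TangentSpace 𝓘(ℝ, E) (b t)}
    (ha : HasMFDerivWithinAt 𝓘(ℝ, ℝ) 𝓘(ℝ, E) a s t ((1 : ℝ →L[ℝ] ℝ).smulRight a'))
    (hb : HasMFDerivWithinAt 𝓘(ℝ, ℝ) 𝓘(ℝ, E) b s t ((1 : ℝ →L[ℝ] ℝ).smulRight b')) :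
    HasMFDerivWithinAt 𝓘(ℝ, ℝ) 𝓘(ℝ, E) (fun r => a r * b r) s t
      ((1 : ℝ →L[ℝ] ℝ).smulRight
        ((mfderiv 𝓘(ℝ, E) 𝓘(ℝ, E) (fun x : G => x * b t) (a t) a' +
          mfderiv 𝓘(ℝ, E) 𝓘(ℝ, E) (fun x : G => a t * x) (b t) b' :
            TangentSpace 𝓘(ℝ, E) (a t * b t)))) := by
  have hm : MDifferentiableAt (𝓘(ℝ, E).prod 𝓘(ℝ, E)) 𝓘(ℝ, E) (fun p : G × G => p.1 * p.2)
      (a t, b t) := (contMDiff_mul 𝓘(ℝ, E) ∞).mdifferentiableAt (by simp)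
  have h := hm.hasMFDerivAt.comp_hasMFDerivWithinAt t (ha.prodMk hb)
  refine HasMFDerivWithinAt.congr_mfderiv h ?_
  refine ContinuousLinearMap.ext fun (r : ℝ) => ?_
  have := mfderiv_prod_eq_add_apply (I := 𝓘(ℝ, E)) (I' := 𝓘(ℝ, E)) (I'' := 𝓘(ℝ, E)) hm
    (v := (r • a', r • b'))
  refine Eq.trans this ?_
  simp only [map_smul]
  exact (smul_add r _ _).symm

end Translations

/-! ### Invariant vector fields in charts -/

section Smooth
open Bundle
variable {E : Type*} [NormedAddCommGroup E] [NormedSpace ℝ E]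
  {G : Type*} [TopologicalSpace G] [ChartedSpace E G] [Group G] [LieGroup 𝓘(ℝ, E) ∞ G]

/-- The derivative of the multiplication, as a smooth map on pairs of tangent vectors. -/
lemma contMDiff_tangent_mul :
    ContMDiff (𝓘(ℝ, E).tangent.prod 𝓘(ℝ, E).tangent) 𝓘(ℝ, E).tangent ∞
      (fun p : TangentBundle 𝓘(ℝ, E) G × TangentBundle 𝓘(ℝ, E) G =>
        (⟨p.1.1 * p.2.1, mfderiv 𝓘(ℝ, E) 𝓘(ℝ, E) (fun x : G => x * p.2.1) p.1.1 p.1.2 +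
          mfderiv 𝓘(ℝ, E) 𝓘(ℝ, E) (fun x : G => p.1.1 * x) p.2.1 p.2.2⟩ :
          TangentBundle 𝓘(ℝ, E) G)) := by
  have S₂ : ContMDiff (𝓘(ℝ, E).tangent.prod 𝓘(ℝ, E).tangent) (𝓘(ℝ, E).prod 𝓘(ℝ, E)).tangent ∞
      (equivTangentBundleProd 𝓘(ℝ, E) G 𝓘(ℝ, E) G).symm :=
    contMDiff_equivTangentBundleProd_symm
  have S₃ : ContMDiff (𝓘(ℝ, E).prod 𝓘(ℝ, E)).tangent 𝓘(ℝ, E).tangent ∞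
      (tangentMap (𝓘(ℝ, E).prod 𝓘(ℝ, E)) 𝓘(ℝ, E) (fun p : G × G => p.1 * p.2)) :=
    (contMDiff_mul 𝓘(ℝ, E) ∞).contMDiff_tangentMap (by simp)
  convert! S₃.comp S₂ with p
  simp only [Function.comp_apply, tangentMap]
  rw [mfderiv_prod_eq_add_apply ((contMDiff_mul 𝓘(ℝ, E) ∞).mdifferentiableAt (by simp))]
  rfl

lemma contMDiff_rightInvariantField (v : GroupLieAlgebra 𝓘(ℝ, E) G) :
    ContMDiff 𝓘(ℝ, E) 𝓘(ℝ, E).tangent ∞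
      (fun g : G => (⟨g, rightInvariantField v g⟩ : TangentBundle 𝓘(ℝ, E) G)) := by
  have h1 : ContMDiff 𝓘(ℝ, E) 𝓘(ℝ, E).tangent ∞
      (fun g : G => (⟨g, 0⟩ : TangentBundle 𝓘(ℝ, E) G)) := contMDiff_zeroSection _ _
  have h2 : ContMDiff 𝓘(ℝ, E) 𝓘(ℝ, E).tangent ∞
      (fun g : G => (⟨1, v⟩ : TangentBundle 𝓘(ℝ, E) G)) := contMDiff_const
  convert! contMDiff_tangent_mul.comp (h2.prodMk h1) with g
  · simp
  · simp [rightInvariantField]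
    rfl

/-- The Maurer–Cartan form is smooth, as a map from the tangent bundle to the Lie algebra. -/
lemma contMDiff_maurerCartan :
    ContMDiff (M' := E) 𝓘(ℝ, E).tangent 𝓘(ℝ, E) ∞
      (fun p : TangentBundle 𝓘(ℝ, E) G => maurerCartan p.1 p.2) := by
  have h0 : ContMDiff 𝓘(ℝ, E).tangent 𝓘(ℝ, E) ∞
      (fun p : TangentBundle 𝓘(ℝ, E) G => p.1⁻¹) :=
    (contMDiff_inv 𝓘(ℝ, E) ∞).comp (contMDiff_proj (TangentSpace 𝓘(ℝ, E) (M := G)))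
  have h1 : ContMDiff 𝓘(ℝ, E).tangent 𝓘(ℝ, E).tangent ∞
      (fun p : TangentBundle 𝓘(ℝ, E) G => (⟨p.1⁻¹, 0⟩ : TangentBundle 𝓘(ℝ, E) G)) :=
    (contMDiff_zeroSection ℝ (TangentSpace 𝓘(ℝ, E) (M := G))).comp h0
  have h2 := contMDiff_tangent_mul.comp (h1.prodMk contMDiff_id)
  have h3 : ContMDiff 𝓘(ℝ, E).tangent 𝓘(ℝ, E).tangent ∞
      (fun p : TangentBundle 𝓘(ℝ, E) G =>
        (⟨1, maurerCartan p.1 p.2⟩ : TangentBundle 𝓘(ℝ, E) G)) := by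
    convert! h2 with p
    · simp
    · simp [maurerCartan]
      rfl
  intro p
  have h4 := (contMDiffAt_totalSpace.1 (h3 p)).2
  refine h4.congr_of_eventuallyEq (Filter.Eventually.of_forall fun q => ?_)
  have h5 := TangentBundle.trivializationAt_apply (I := 𝓘(ℝ, E)) (1 : G)
    ⟨1, maurerCartan q.1 q.2⟩
  exact ((congrArg Prod.snd h5).trans (tangentCoordChange_self (I := 𝓘(ℝ, E)) (x := (1 : G))
    (z := 1) (mem_extChartAt_source (1 : G)))).symm

end Smooth

section LocalProduct
open Bundle
variable {E : Type*} [NormedAddCommGroup E] [NormedSpace ℝ E]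
  {G : Type*} [TopologicalSpace G] [ChartedSpace E G] [Group G] [LieGroup 𝓘(ℝ, E) ∞ G]

variable (E G) in
/-- The multiplication of `G`, read in the preferred chart at the identity. -/
def localMul (p : E × E) : E :=
  extChartAt 𝓘(ℝ, E) (1 : G)
    ((extChartAt 𝓘(ℝ, E) (1 : G)).symm p.1 * (extChartAt 𝓘(ℝ, E) (1 : G)).symm p.2)

variable (E G) in
/-- The coordinates of the identity in the preferred chart at the identity. -/
def chartOne : E := extChartAt 𝓘(ℝ, E) (1 : G) 1

lemma chartOne_mem_target : chartOne E G ∈ (extChartAt 𝓘(ℝ, E) (1 : G)).target :=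
  mem_extChartAt_target (1 : G)

lemma extChartAt_symm_chartOne : (extChartAt 𝓘(ℝ, E) (1 : G)).symm (chartOne E G) = 1 :=
  extChartAt_to_inv (1 : G)

lemma contMDiffAt_extChartAt_one_symm {x : E} (hx : x ∈ (extChartAt 𝓘(ℝ, E) (1 : G)).target) :
    ContMDiffAt 𝓘(ℝ, E) 𝓘(ℝ, E) ∞ (extChartAt 𝓘(ℝ, E) (1 : G)).symm x :=
  (contMDiffOn_extChartAt_symm (1 : G)).contMDiffAt ((isOpen_extChartAt_target (1 : G)).mem_nhds hx)

lemma contDiffAt_localMul {p : E × E} (h1 : p.1 ∈ (extChartAt 𝓘(ℝ, E) (1 : G)).target)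
    (h2 : p.2 ∈ (extChartAt 𝓘(ℝ, E) (1 : G)).target)
    (h : (extChartAt 𝓘(ℝ, E) (1 : G)).symm p.1 * (extChartAt 𝓘(ℝ, E) (1 : G)).symm p.2 ∈
      (extChartAt 𝓘(ℝ, E) (1 : G)).source) :
    ContDiffAt ℝ ∞ (localMul E G) p := by
  rw [← contMDiffAt_iff_contDiffAt]
  have e1 : ContMDiffAt 𝓘(ℝ, E × E) 𝓘(ℝ, E) ∞
      (fun p : E × E => (extChartAt 𝓘(ℝ, E) (1 : G)).symm p.1) p :=
    (contMDiffAt_extChartAt_one_symm h1).comp p contDiff_fst.contMDiff.contMDiffAt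
  have e2 : ContMDiffAt 𝓘(ℝ, E × E) 𝓘(ℝ, E) ∞
      (fun p : E × E => (extChartAt 𝓘(ℝ, E) (1 : G)).symm p.2) p :=
    (contMDiffAt_extChartAt_one_symm h2).comp p contDiff_snd.contMDiff.contMDiffAt
  refine ContMDiffAt.comp (I' := 𝓘(ℝ, E)) p (g := extChartAt 𝓘(ℝ, E) (1 : G)) ?_ (e1.mul e2)
  exact contMDiffAt_extChartAt' (by simpa using h)

lemma localMul_chartOne_left {z : E} (hz : z ∈ (extChartAt 𝓘(ℝ, E) (1 : G)).target) :
    localMul E G (chartOne E G, z) = z := by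
  simp only [localMul, extChartAt_symm_chartOne, one_mul]
  exact (extChartAt 𝓘(ℝ, E) (1 : G)).right_inv hz

lemma localMul_chartOne_right {z : E} (hz : z ∈ (extChartAt 𝓘(ℝ, E) (1 : G)).target) :
    localMul E G (z, chartOne E G) = z := by
  simp only [localMul, extChartAt_symm_chartOne, mul_one]
  exact (extChartAt 𝓘(ℝ, E) (1 : G)).right_inv hz

lemma contDiffAt_localMul_right {x : E} (hx : x ∈ (extChartAt 𝓘(ℝ, E) (1 : G)).target) :
    ContDiffAt ℝ ∞ (localMul E G) (x, chartOne E G) := by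
  refine contDiffAt_localMul hx chartOne_mem_target ?_
  simp only [extChartAt_symm_chartOne, mul_one]
  exact (extChartAt 𝓘(ℝ, E) (1 : G)).map_target hx

lemma contDiffAt_localMul_left {x : E} (hx : x ∈ (extChartAt 𝓘(ℝ, E) (1 : G)).target) :
    ContDiffAt ℝ ∞ (localMul E G) (chartOne E G, x) := by
  refine contDiffAt_localMul chartOne_mem_target hx ?_
  simp only [extChartAt_symm_chartOne, one_mul]
  exact (extChartAt 𝓘(ℝ, E) (1 : G)).map_target hx

variable (E G) in
/-- The derivative at the identity of the preferred chart. -/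
def chartDeriv : GroupLieAlgebra 𝓘(ℝ, E) G →L[ℝ] E :=
  mfderiv 𝓘(ℝ, E) 𝓘(ℝ, E) (extChartAt 𝓘(ℝ, E) (1 : G)) (1 : G)

lemma mfderiv_symm_chartDeriv (v : GroupLieAlgebra 𝓘(ℝ, E) G) :
    (mfderiv 𝓘(ℝ, E) 𝓘(ℝ, E) (extChartAt 𝓘(ℝ, E) (1 : G)).symm (chartOne E G)
      (chartDeriv E G v) : E) = v := by
  have h := mfderivWithin_extChartAt_symm_comp_mfderiv_extChartAt' (I := 𝓘(ℝ, E))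
    (mem_extChartAt_source (I := 𝓘(ℝ, E)) (1 : G))
  have h' := congrArg (fun T => T v) h
  simp only [modelWithCornersSelf_coe, range_id, mfderivWithin_univ] at h'
  exact h'

/-- In the preferred chart at the identity, left invariant vector fields are the partial derivatives
of the multiplication in the second variable. -/
lemma mfderiv_symm_localMul_left {x : E} (hx : x ∈ (extChartAt 𝓘(ℝ, E) (1 : G)).target)
    (w : GroupLieAlgebra 𝓘(ℝ, E) G) :
    (mfderiv 𝓘(ℝ, E) 𝓘(ℝ, E) (extChartAt 𝓘(ℝ, E) (1 : G)).symm x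
      (fderiv ℝ (localMul E G) (x, chartOne E G) (0, chartDeriv E G w)) : E) =
    mulInvariantVectorField w ((extChartAt 𝓘(ℝ, E) (1 : G)).symm x) := by
  set φ := extChartAt 𝓘(ℝ, E) (1 : G) with hφ
  set g := φ.symm x with hg
  have hgs : g ∈ φ.source := φ.map_target hx
  have hsymm : MDifferentiableAt 𝓘(ℝ, E) 𝓘(ℝ, E) φ.symm (chartOne E G) :=
    (contMDiffAt_extChartAt_one_symm chartOne_mem_target).mdifferentiableAt (by simp)
  have hsymmx : MDifferentiableAt 𝓘(ℝ, E) 𝓘(ℝ, E) φ.symm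
      (localMul E G (x, chartOne E G)) := by
    rw [localMul_chartOne_right hx]
    exact (contMDiffAt_extChartAt_one_symm hx).mdifferentiableAt (by simp)
  have h1 : HasMFDerivAt 𝓘(ℝ, E) 𝓘(ℝ, E) (fun z => g * φ.symm z) (chartOne E G)
      ((mfderiv 𝓘(ℝ, E) 𝓘(ℝ, E) (fun y => g * y) (φ.symm (chartOne E G))).comp
        (mfderiv 𝓘(ℝ, E) 𝓘(ℝ, E) φ.symm (chartOne E G))) :=
    (mdifferentiableAt_mul_left g _).hasMFDerivAt.comp (chartOne E G) hsymm.hasMFDerivAt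
  have hd : HasFDerivAt (fun z => localMul E G (x, z))
      ((fderiv ℝ (localMul E G) (x, chartOne E G)).comp (ContinuousLinearMap.inr ℝ E E))
      (chartOne E G) :=
    ((contDiffAt_localMul_right hx).differentiableAt (by simp)).hasFDerivAt.comp (chartOne E G)
      (hasFDerivAt_prodMk_right x (chartOne E G))
  have h2 := hsymmx.hasMFDerivAt.comp (chartOne E G) hd.hasMFDerivAt
  have hev : (fun z => φ.symm (localMul E G (x, z))) =ᶠ[nhds (chartOne E G)]
      (fun z => g * φ.symm z) := by
    have hc : ContinuousAt (fun z => g * φ.symm z) (chartOne E G) := h1.continuousAt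
    have hmem : φ.source ∈ nhds (g * φ.symm (chartOne E G)) := by
      rw [extChartAt_symm_chartOne, mul_one]
      exact (isOpen_extChartAt_source (1 : G)).mem_nhds hgs
    filter_upwards [hc.preimage_mem_nhds hmem] with z hz
    exact φ.left_inv hz
  have h3 := hasMFDerivAt_unique h2 (h1.congr_of_eventuallyEq hev)
  have h4 := congrArg (fun T => T (chartDeriv E G w)) h3
  have e1 : ∀ (y : E) (u : E), y = x → (mfderiv 𝓘(ℝ, E) 𝓘(ℝ, E) φ.symm y u : E) =
      mfderiv 𝓘(ℝ, E) 𝓘(ℝ, E) φ.symm x u := by rintro y u rfl; rfl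
  have e2 : (mfderiv 𝓘(ℝ, E) 𝓘(ℝ, E) (fun y => g * y) (φ.symm (chartOne E G))
      (mfderiv 𝓘(ℝ, E) 𝓘(ℝ, E) φ.symm (chartOne E G) (chartDeriv E G w)) : E) =
      mulInvariantVectorField w g :=
    (mfderiv_mul_left_congr (E := E) rfl (extChartAt_symm_chartOne (E := E) (G := G)) _).trans
      (congrArg (leftInvariantCLM g) (mfderiv_symm_chartDeriv w))
  exact (e1 _ _ (localMul_chartOne_right hx)).symm.trans (h4.trans e2)

/-- In the preferred chart at the identity, right invariant vector fields are the partial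
derivatives of the multiplication in the first variable. -/
lemma mfderiv_symm_localMul_right {x : E} (hx : x ∈ (extChartAt 𝓘(ℝ, E) (1 : G)).target)
    (w : GroupLieAlgebra 𝓘(ℝ, E) G) :
    (mfderiv 𝓘(ℝ, E) 𝓘(ℝ, E) (extChartAt 𝓘(ℝ, E) (1 : G)).symm x
      (fderiv ℝ (localMul E G) (chartOne E G, x) (chartDeriv E G w, 0)) : E) =
    rightInvariantField w ((extChartAt 𝓘(ℝ, E) (1 : G)).symm x) := by
  set φ := extChartAt 𝓘(ℝ, E) (1 : G) with hφ
  set g := φ.symm x with hg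
  have hgs : g ∈ φ.source := φ.map_target hx
  have hsymm : MDifferentiableAt 𝓘(ℝ, E) 𝓘(ℝ, E) φ.symm (chartOne E G) :=
    (contMDiffAt_extChartAt_one_symm chartOne_mem_target).mdifferentiableAt (by simp)
  have hsymmx : MDifferentiableAt 𝓘(ℝ, E) 𝓘(ℝ, E) φ.symm
      (localMul E G (chartOne E G, x)) := by
    rw [localMul_chartOne_left hx]
    exact (contMDiffAt_extChartAt_one_symm hx).mdifferentiableAt (by simp)
  have h1 : HasMFDerivAt 𝓘(ℝ, E) 𝓘(ℝ, E) (fun z => φ.symm z * g) (chartOne E G)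
      ((mfderiv 𝓘(ℝ, E) 𝓘(ℝ, E) (fun y => y * g) (φ.symm (chartOne E G))).comp
        (mfderiv 𝓘(ℝ, E) 𝓘(ℝ, E) φ.symm (chartOne E G))) :=
    (mdifferentiableAt_mul_right g _).hasMFDerivAt.comp (chartOne E G) hsymm.hasMFDerivAt
  have hd : HasFDerivAt (fun z => localMul E G (z, x))
      ((fderiv ℝ (localMul E G) (chartOne E G, x)).comp (ContinuousLinearMap.inl ℝ E E))
      (chartOne E G) :=
    HasFDerivAt.comp (f := fun z => (z, x)) (chartOne E G)
      ((contDiffAt_localMul_left hx).differentiableAt (by simp)).hasFDerivAt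
      (hasFDerivAt_prodMk_left (chartOne E G) x)
  have h2 := hsymmx.hasMFDerivAt.comp (chartOne E G) hd.hasMFDerivAt
  have hev : (fun z => φ.symm (localMul E G (z, x))) =ᶠ[nhds (chartOne E G)]
      (fun z => φ.symm z * g) := by
    have hc : ContinuousAt (fun z => φ.symm z * g) (chartOne E G) := h1.continuousAt
    have hmem : φ.source ∈ nhds (φ.symm (chartOne E G) * g) := by
      rw [extChartAt_symm_chartOne, one_mul]
      exact (isOpen_extChartAt_source (1 : G)).mem_nhds hgs
    filter_upwards [hc.preimage_mem_nhds hmem] with z hz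
    exact φ.left_inv hz
  have h3 := hasMFDerivAt_unique h2 (h1.congr_of_eventuallyEq hev)
  have h4 := congrArg (fun T => T (chartDeriv E G w)) h3
  have e1 : ∀ (y : E) (u : E), y = x → (mfderiv 𝓘(ℝ, E) 𝓘(ℝ, E) φ.symm y u : E) =
      mfderiv 𝓘(ℝ, E) 𝓘(ℝ, E) φ.symm x u := by rintro y u rfl; rfl
  have e2 : (mfderiv 𝓘(ℝ, E) 𝓘(ℝ, E) (fun y => y * g) (φ.symm (chartOne E G))
      (mfderiv 𝓘(ℝ, E) 𝓘(ℝ, E) φ.symm (chartOne E G) (chartDeriv E G w)) : E) =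
      rightInvariantField w g :=
    (mfderiv_mul_right_congr (E := E) rfl (extChartAt_symm_chartOne (E := E) (G := G)) _).trans
      (congrArg (mfderiv 𝓘(ℝ, E) 𝓘(ℝ, E) (fun y => y * g) (1 : G)) (mfderiv_symm_chartDeriv w))
  exact (e1 _ _ (localMul_chartOne_left hx)).symm.trans (h4.trans e2)

lemma fderiv_localMul_chartOne_inr (u : E) :
    fderiv ℝ (localMul E G) (chartOne E G, chartOne E G) (0, u) = u := by
  have hd : HasFDerivAt (fun z => localMul E G (chartOne E G, z))
      ((fderiv ℝ (localMul E G) (chartOne E G, chartOne E G)).comp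
        (ContinuousLinearMap.inr ℝ E E)) (chartOne E G) :=
    ((contDiffAt_localMul_left chartOne_mem_target).differentiableAt (by simp)).hasFDerivAt.comp
      (chartOne E G) (hasFDerivAt_prodMk_right _ (chartOne E G))
  have hev : (fun z => localMul E G (chartOne E G, z)) =ᶠ[nhds (chartOne E G)] id := by
    filter_upwards [(isOpen_extChartAt_target (1 : G)).mem_nhds chartOne_mem_target] with z hz
    exact localMul_chartOne_left hz
  have h3 := hd.unique ((hasFDerivAt_id _).congr_of_eventuallyEq hev)
  simpa using congrArg (fun T => T u) h3

lemma fderiv_localMul_chartOne_inl (u : E) :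
    fderiv ℝ (localMul E G) (chartOne E G, chartOne E G) (u, 0) = u := by
  have hd : HasFDerivAt (fun z => localMul E G (z, chartOne E G))
      ((fderiv ℝ (localMul E G) (chartOne E G, chartOne E G)).comp
        (ContinuousLinearMap.inl ℝ E E)) (chartOne E G) :=
    HasFDerivAt.comp (f := fun z => (z, chartOne E G)) (chartOne E G)
      ((contDiffAt_localMul_left chartOne_mem_target).differentiableAt (by simp)).hasFDerivAt
      (hasFDerivAt_prodMk_left (chartOne E G) _)
  have hev : (fun z => localMul E G (z, chartOne E G)) =ᶠ[nhds (chartOne E G)] id := by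
    filter_upwards [(isOpen_extChartAt_target (1 : G)).mem_nhds chartOne_mem_target] with z hz
    exact localMul_chartOne_right hz
  have h3 := hd.unique ((hasFDerivAt_id _).congr_of_eventuallyEq hev)
  simpa using congrArg (fun T => T u) h3

end LocalProduct

section Commute
variable {E : Type*} [NormedAddCommGroup E] [NormedSpace ℝ E] [CompleteSpace E]
  {G : Type*} [TopologicalSpace G] [ChartedSpace E G] [Group G] [LieGroup 𝓘(ℝ, E) ∞ G]
open VectorField

lemma minSmoothness_two_le_infty : minSmoothness ℝ 2 ≤ (∞ : WithTop ℕ∞) := by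
  rw [minSmoothness_of_isRCLikeNormedField]
  exact WithTop.coe_le_coe.2 (le_top : (2 : ℕ∞) ≤ ⊤)

lemma inverse_mfderiv_symm_apply {x : E} (hx : x ∈ (extChartAt 𝓘(ℝ, E) (1 : G)).target)
    (u : E) (w : TangentSpace 𝓘(ℝ, E) ((extChartAt 𝓘(ℝ, E) (1 : G)).symm x))
    (h : (mfderiv 𝓘(ℝ, E) 𝓘(ℝ, E) (extChartAt 𝓘(ℝ, E) (1 : G)).symm x u : E) = w) :
    ((mfderiv 𝓘(ℝ, E) 𝓘(ℝ, E) (extChartAt 𝓘(ℝ, E) (1 : G)).symm x).inverse w : E) = u := by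
  have hinv := isInvertible_mfderivWithin_extChartAt_symm (I := 𝓘(ℝ, E)) hx
  simp only [modelWithCornersSelf_coe, range_id, mfderivWithin_univ] at hinv
  have h' : (mfderiv 𝓘(ℝ, E) 𝓘(ℝ, E) (extChartAt 𝓘(ℝ, E) (1 : G)).symm x u) = w := h
  rw [← h']
  obtain ⟨e, he⟩ := hinv
  rw [← he, ContinuousLinearMap.inverse_equiv]
  exact e.symm_apply_apply u

/-- Left and right invariant vector fields commute at the identity, by symmetry of the second
derivative of the multiplication. -/
lemma mlieBracket_left_right_one (w v : GroupLieAlgebra 𝓘(ℝ, E) G) :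
    mlieBracket 𝓘(ℝ, E) (mulInvariantVectorField w) (rightInvariantField v) (1 : G) = 0 := by
  rw [← mlieBracketWithin_univ, mlieBracketWithin_apply]
  have hL : mpullbackWithin 𝓘(ℝ, E) 𝓘(ℝ, E) (extChartAt 𝓘(ℝ, E) (1 : G)).symm
      (mulInvariantVectorField w) (range 𝓘(ℝ, E)) =ᶠ[nhds (chartOne E G)]
      fun x => (fderiv ℝ (localMul E G) (x, chartOne E G) (0, chartDeriv E G w) : E) := by
    filter_upwards [(isOpen_extChartAt_target (1 : G)).mem_nhds chartOne_mem_target] with x hx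
    simp only [mpullbackWithin_apply, modelWithCornersSelf_coe, range_id, mfderivWithin_univ]
    exact inverse_mfderiv_symm_apply hx _ _ (mfderiv_symm_localMul_left hx w)
  have hR : mpullbackWithin 𝓘(ℝ, E) 𝓘(ℝ, E) (extChartAt 𝓘(ℝ, E) (1 : G)).symm
      (rightInvariantField v) (range 𝓘(ℝ, E)) =ᶠ[nhds (chartOne E G)]
      fun x => (fderiv ℝ (localMul E G) (chartOne E G, x) (chartDeriv E G v, 0) : E) := by
    filter_upwards [(isOpen_extChartAt_target (1 : G)).mem_nhds chartOne_mem_target] with x hx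
    simp only [mpullbackWithin_apply, modelWithCornersSelf_coe, range_id, mfderivWithin_univ]
    exact inverse_mfderiv_symm_apply hx _ _ (mfderiv_symm_localMul_right hx v)
  have hc := contDiffAt_localMul_left (E := E) (G := G) chartOne_mem_target
  have hd : HasFDerivAt (fderiv ℝ (localMul E G))
      (fderiv ℝ (fderiv ℝ (localMul E G)) (chartOne E G, chartOne E G))
      (chartOne E G, chartOne E G) :=
    ((hc.fderiv_right (m := 1) (by norm_cast)).differentiableAt (by simp)).hasFDerivAt
  have hsymm : IsSymmSndFDerivAt ℝ (localMul E G) (chartOne E G, chartOne E G) :=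
    hc.isSymmSndFDerivAt minSmoothness_two_le_infty
  have dL : HasFDerivAt (fun x => fderiv ℝ (localMul E G) (x, chartOne E G) (0, chartDeriv E G w))
      (((ContinuousLinearMap.apply ℝ E ((0, chartDeriv E G w) : E × E))).comp
        ((fderiv ℝ (fderiv ℝ (localMul E G)) (chartOne E G, chartOne E G)).comp
        (ContinuousLinearMap.inl ℝ E E))) (chartOne E G) :=
    (ContinuousLinearMap.apply ℝ E ((0, chartDeriv E G w) : E × E)).hasFDerivAt.comp
      (chartOne E G) (HasFDerivAt.comp (f := fun z => (z, chartOne E G)) (chartOne E G) hd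
        (hasFDerivAt_prodMk_left _ _))
  have dR : HasFDerivAt (fun x => fderiv ℝ (localMul E G) (chartOne E G, x) (chartDeriv E G v, 0))
      (((ContinuousLinearMap.apply ℝ E ((chartDeriv E G v, 0) : E × E))).comp
        ((fderiv ℝ (fderiv ℝ (localMul E G)) (chartOne E G, chartOne E G)).comp
        (ContinuousLinearMap.inr ℝ E E))) (chartOne E G) :=
    (ContinuousLinearMap.apply ℝ E ((chartDeriv E G v, 0) : E × E)).hasFDerivAt.comp
      (chartOne E G) (hd.comp (chartOne E G) (hasFDerivAt_prodMk_right _ _))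
  have key : lieBracket ℝ
      (fun x => fderiv ℝ (localMul E G) (x, chartOne E G) (0, chartDeriv E G w))
      (fun x => fderiv ℝ (localMul E G) (chartOne E G, x) (chartDeriv E G v, 0))
      (chartOne E G) = 0 := by
    rw [lieBracket, dL.fderiv, dR.fderiv, fderiv_localMul_chartOne_inr,
      fderiv_localMul_chartOne_inl]
    simp only [ContinuousLinearMap.comp_apply, ContinuousLinearMap.apply_apply,
      ContinuousLinearMap.inl_apply, ContinuousLinearMap.inr_apply]
    rw [hsymm.eq, sub_self]
  have key2 := (hL.lieBracket_vectorField_eq hR).trans key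
  simp only [preimage_univ, modelWithCornersSelf_coe, range_id, inter_self] at key2 ⊢
  have key3 := (congrFun lieBracketWithin_univ (chartOne E G)).trans key2
  exact (congrArg ((mfderiv 𝓘(ℝ, E) 𝓘(ℝ, E) (extChartAt 𝓘(ℝ, E) (1 : G)) (1 : G)).inverse)
    key3).trans (map_zero _)

end Commute

/-! ### Lie brackets of left and right invariant vector fields -/

section SmoothCurves

variable {E : Type*} [NormedAddCommGroup E] [NormedSpace ℝ E]
  {M : Type*} [TopologicalSpace M] [ChartedSpace E M] [IsManifold 𝓘(ℝ, E) ∞ M]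

/-- Any two points in a small neighbourhood of a point of a manifold are joined by a smooth curve. -/
lemma exists_nhds_smooth_curve (x : M) : ∃ V : Set M, IsOpen V ∧ x ∈ V ∧ ∀ y ∈ V, ∀ z ∈ V,
    ∃ c : ℝ → M, ContMDiff 𝓘(ℝ, ℝ) 𝓘(ℝ, E) ∞ c ∧ c 0 = y ∧ c 1 = z := by
  set φ := extChartAt 𝓘(ℝ, E) x with hφ
  obtain ⟨ε, hε, hball⟩ := Metric.isOpen_iff.1 (isOpen_extChartAt_target (I := 𝓘(ℝ, E)) x) (φ x)
    (mem_extChartAt_target x)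
  refine ⟨φ.source ∩ φ ⁻¹' Metric.ball (φ x) ε,
    (continuousOn_extChartAt x).isOpen_inter_preimage (isOpen_extChartAt_source x)
      Metric.isOpen_ball, ⟨mem_extChartAt_source x, Metric.mem_ball_self hε⟩, ?_⟩
  rintro y ⟨hy, hy'⟩ z ⟨hz, hz'⟩
  have hmem : ∀ t : ℝ, φ y + Real.smoothTransition t • (φ z - φ y) ∈ Metric.ball (φ x) ε :=
    fun t => (convex_ball (φ x) ε).add_smul_sub_mem hy' hz'
      ⟨Real.smoothTransition.nonneg t, Real.smoothTransition.le_one t⟩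
  refine ⟨fun t => φ.symm (φ y + Real.smoothTransition t • (φ z - φ y)), ?_, ?_, ?_⟩
  · have h1 : ContDiff ℝ ∞ (fun t : ℝ => φ y + Real.smoothTransition t • (φ z - φ y)) :=
      contDiff_const.add (Real.smoothTransition.contDiff.smul contDiff_const)
    exact (contMDiffOn_extChartAt_symm x).comp_contMDiff h1.contMDiff fun t => hball (hmem t)
  · simp [φ.left_inv hy]
  · simp [φ.left_inv hz]

/-- A nonempty subset of a connected manifold that contains the end point of every smooth curve
starting in it is everything. -/
lemma eq_univ_of_smooth_curve [ConnectedSpace M] {S : Set M} (hne : S.Nonempty)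
    (hS : ∀ c : ℝ → M, ContMDiff 𝓘(ℝ, ℝ) 𝓘(ℝ, E) ∞ c → c 0 ∈ S → c 1 ∈ S) : S = univ := by
  refine IsClopen.eq_univ ⟨⟨?_⟩, ?_⟩ hne
  · refine isOpen_iff_forall_mem_open.2 fun x hx => ?_
    obtain ⟨V, hV, hxV, h⟩ := exists_nhds_smooth_curve (E := E) x
    refine ⟨V, fun y hy hyS => ?_, hV, hxV⟩
    obtain ⟨c, hc, h0, h1⟩ := h y hy x hxV
    exact hx (h1 ▸ hS c hc (h0 ▸ hyS))
  · refine isOpen_iff_forall_mem_open.2 fun x hx => ?_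
    obtain ⟨V, hV, hxV, h⟩ := exists_nhds_smooth_curve (E := E) x
    refine ⟨V, fun y hy => ?_, hV, hxV⟩
    obtain ⟨c, hc, h0, h1⟩ := h x hxV y hy
    exact h1 ▸ hS c hc (h0 ▸ hx)

lemma eq_of_mfderiv_eq_zero [ConnectedSpace M] {F : Type*} [NormedAddCommGroup F] [NormedSpace ℝ F]
    {f : M → F} (hf : MDifferentiable 𝓘(ℝ, E) 𝓘(ℝ, F) f)
    (h : ∀ x (w : TangentSpace 𝓘(ℝ, E) x), (mfderiv 𝓘(ℝ, E) 𝓘(ℝ, F) f x w : F) = 0) (x y : M) :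
    f x = f y := by
  have : {z | f z = f y} = univ := by
    refine eq_univ_of_smooth_curve (E := E) ⟨y, rfl⟩ fun c hc h0 => ?_
    have hd : ∀ t, HasDerivAt (f ∘ c) 0 t := fun t => by
      have h1 := (hf (c t)).hasMFDerivAt.comp t (hc.mdifferentiableAt (by simp)).hasMFDerivAt
      exact HasDerivAt.congr_deriv (HasFDerivAt.hasDerivAt h1.hasFDerivAt) (h (c t) _)
    have := is_const_of_deriv_eq_zero (fun t => (hd t).differentiableAt) (fun t => (hd t).deriv) 1 0
    exact Eq.trans this h0
  exact (this ▸ mem_univ x : x ∈ {z | f z = f y})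

end SmoothCurves

section Brackets
open VectorField
variable {E : Type*} [NormedAddCommGroup E] [NormedSpace ℝ E] [FiniteDimensional ℝ E]
  {G : Type*} [TopologicalSpace G] [ChartedSpace E G] [Group G] [LieGroup 𝓘(ℝ, E) ∞ G]

instance : FiniteDimensional ℝ (GroupLieAlgebra 𝓘(ℝ, E) G) := inferInstanceAs (FiniteDimensional ℝ E)

lemma mdifferentiable_rightInvariantField (v : GroupLieAlgebra 𝓘(ℝ, E) G) :
    MDifferentiable 𝓘(ℝ, E) 𝓘(ℝ, E).tangent
      (fun g : G => (⟨g, rightInvariantField v g⟩ : TangentBundle 𝓘(ℝ, E) G)) :=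
  (contMDiff_rightInvariantField v).mdifferentiable (by simp)

/-- Left translations permute the right invariant vector fields. -/
lemma mpullback_mul_left_rightInvariantField (g : G) (v : GroupLieAlgebra 𝓘(ℝ, E) G) :
    ∃ v' : GroupLieAlgebra 𝓘(ℝ, E) G,
      mpullback 𝓘(ℝ, E) 𝓘(ℝ, E) (fun x : G => g * x) (rightInvariantField v) =
        rightInvariantField v' := by
  refine ⟨(mfderiv 𝓘(ℝ, E) 𝓘(ℝ, E) (fun x : G => x * g) g⁻¹
    (mfderiv 𝓘(ℝ, E) 𝓘(ℝ, E) (fun x : G => g⁻¹ * x) (1 : G) v : E) : E), ?_⟩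
  ext h
  rw [mpullback_apply, inverse_mfderiv_mul_left]
  have h1 := mfderiv_mul_left_mul_right (E := E) g⁻¹ (g * h) 1 v
  have h2 := mfderiv_mul_right_mul_right (E := E) g h (g⁻¹ : G)
    (mfderiv 𝓘(ℝ, E) 𝓘(ℝ, E) (fun x : G => g⁻¹ * x) (1 : G) v : E)
  refine (mfderiv_mul_left_congr (E := E) rfl (one_mul (g * h)).symm _).trans (h1.trans ?_)
  refine (mfderiv_mul_right_congr (E := E) rfl (mul_one g⁻¹) _).trans (h2.symm.trans ?_)
  exact mfderiv_mul_right_congr (E := E) rfl (inv_mul_cancel g) _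

lemma eq_zero_of_maurerCartan_eq_zero {g : G} {w : TangentSpace 𝓘(ℝ, E) g}
    (h : maurerCartan g w = 0) : w = 0 := by
  rw [← mulInvariantVectorField_maurerCartan g w, h]
  exact map_zero (leftInvariantCLM g)

/-- Left invariant and right invariant vector fields commute: by `mlieBracket_left_right_one` their
bracket vanishes at the identity, and left translations preserve the former and permute the
latter. -/
lemma mlieBracket_left_right (w v : GroupLieAlgebra 𝓘(ℝ, E) G) (g : G) :
    mlieBracket 𝓘(ℝ, E) (mulInvariantVectorField w) (rightInvariantField v) g = 0 := by
  have := FiniteDimensional.complete ℝ E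
  obtain ⟨v', hv'⟩ := mpullback_mul_left_rightInvariantField g v
  have h := mpullback_mlieBracket (n := ∞) (I := 𝓘(ℝ, E)) (I' := 𝓘(ℝ, E)) (x₀ := (1 : G))
    (f := fun x : G => g * x) (V := mulInvariantVectorField w) (W := rightInvariantField v)
    (mdifferentiableAt_mulInvariantVectorField w) (mdifferentiable_rightInvariantField v _)
    contMDiff_mul_left.contMDiffAt minSmoothness_two_le_infty
  rw [hv', mpullback_mulInvariantVectorField, mlieBracket_left_right_one, mpullback_apply,
    inverse_mfderiv_mul_left] at h
  rw [mul_one] at h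
  exact eq_zero_of_maurerCartan_eq_zero h

/-- The coefficients of a vector field in the frame of left invariant vector fields given by
a basis of the Lie algebra. -/
lemma eq_sum_mulInvariantVectorField {ι : Type*} [Fintype ι]
    (b : Module.Basis ι ℝ (GroupLieAlgebra 𝓘(ℝ, E) G)) (W : (g : G) → TangentSpace 𝓘(ℝ, E) g) :
    W = ∑ i, (fun g => b.repr (maurerCartan g (W g)) i) • mulInvariantVectorField (b i) := by
  ext g
  simp only [Finset.sum_apply]
  conv_lhs =>
    rw [← mulInvariantVectorField_maurerCartan g (W g), ← b.sum_repr (maurerCartan g (W g))]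
  rw [← leftInvariantCLM_apply, map_sum]
  refine Finset.sum_congr rfl fun i _ => ?_
  rw [map_smul]; rfl

lemma mlieBracket_sum_left {ι : Type*} (s : Finset ι) (V : ι → (g : G) → TangentSpace 𝓘(ℝ, E) g)
    (Y : (g : G) → TangentSpace 𝓘(ℝ, E) g) (g : G)
    (hV : ∀ i, MDifferentiableAt 𝓘(ℝ, E) 𝓘(ℝ, E).tangent
      (fun g : G => (⟨g, V i g⟩ : TangentBundle 𝓘(ℝ, E) G)) g) :
    MDifferentiableAt 𝓘(ℝ, E) 𝓘(ℝ, E).tangent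
      (fun g : G => (⟨g, (∑ i ∈ s, V i) g⟩ : TangentBundle 𝓘(ℝ, E) G)) g ∧
    mlieBracket 𝓘(ℝ, E) (∑ i ∈ s, V i) Y g = ∑ i ∈ s, mlieBracket 𝓘(ℝ, E) (V i) Y g := by
  classical
  have := FiniteDimensional.complete ℝ E
  induction s using Finset.induction_on with
  | empty =>
    simp only [Finset.sum_empty, mlieBracket_zero_left]
    refine ⟨?_, rfl⟩
    exact (Bundle.contMDiff_zeroSection (n := 1) ℝ
      (TangentSpace 𝓘(ℝ, E) (M := G))).mdifferentiable one_ne_zero g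
  | insert a s ha ih =>
    simp only [Finset.sum_insert ha]
    refine ⟨mdifferentiableAt_add_section (hV a) ih.1, ?_⟩
    rw [mlieBracket_add_left (hV a) ih.1, ih.2]

/-- The bracket of a vector field with another one, in the frame of left invariant vector fields. -/
lemma mlieBracket_eq_of_maurerCartan {ι : Type*} [Fintype ι]
    (b : Module.Basis ι ℝ (GroupLieAlgebra 𝓘(ℝ, E) G)) {W : (g : G) → TangentSpace 𝓘(ℝ, E) g}
    (Y : (g : G) → TangentSpace 𝓘(ℝ, E) g) {g : G} {K' : TangentSpace 𝓘(ℝ, E) g →L[ℝ] E}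
    (hK : HasMFDerivAt (M' := E) 𝓘(ℝ, E) 𝓘(ℝ, E) (fun h => maurerCartan h (W h)) g K') :
    mlieBracket 𝓘(ℝ, E) W Y g = -mulInvariantVectorField (K' (Y g) : E) g +
      ∑ i, b.repr (maurerCartan g (W g)) i •
        mlieBracket 𝓘(ℝ, E) (mulInvariantVectorField (b i)) Y g := by
  have := FiniteDimensional.complete ℝ E
  let ℓ : ι → E →L[ℝ] ℝ := fun i => LinearMap.toContinuousLinearMap (b.coord i)
  have hf : ∀ i, HasMFDerivAt 𝓘(ℝ, E) 𝓘(ℝ, ℝ) (fun h => b.repr (maurerCartan h (W h)) i) g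
      ((ℓ i).comp K') := fun i =>
    HasMFDerivAt.comp (I' := 𝓘(ℝ, E)) g ((ℓ i).hasFDerivAt.hasMFDerivAt) hK
  have hsm : ∀ i, MDifferentiableAt 𝓘(ℝ, E) 𝓘(ℝ, E).tangent
      (fun h : G => (⟨h, ((fun h => b.repr (maurerCartan h (W h)) i) •
        mulInvariantVectorField (b i)) h⟩ : TangentBundle 𝓘(ℝ, E) G)) g := fun i =>
    (hf i).mdifferentiableAt.smul_section (mdifferentiableAt_mulInvariantVectorField (b i))
  conv_lhs => rw [eq_sum_mulInvariantVectorField b W]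
  rw [(mlieBracket_sum_left Finset.univ _ Y g hsm).2]
  have hterm : ∀ i, mlieBracket 𝓘(ℝ, E) ((fun h => b.repr (maurerCartan h (W h)) i) •
        mulInvariantVectorField (b i)) Y g =
      -(ℓ i (K' (Y g)) • mulInvariantVectorField (b i) g) + b.repr (maurerCartan g (W g)) i •
        mlieBracket 𝓘(ℝ, E) (mulInvariantVectorField (b i)) Y g := fun i => by
    rw [mlieBracket_smul_left (hf i).mdifferentiableAt
      (mdifferentiableAt_mulInvariantVectorField (b i)), mvfderiv, (hf i).mfderiv, neg_smul]
    rfl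
  rw [Finset.sum_congr rfl fun i _ => hterm i, Finset.sum_add_distrib, Finset.sum_neg_distrib]
  congr 2
  conv_rhs => rw [← b.sum_repr (K' (Y g) : E)]
  rw [← leftInvariantCLM_apply, map_sum]
  refine Finset.sum_congr rfl fun i _ => ?_
  rw [map_smul]; rfl

lemma hasMFDerivAt_maurerCartan {W : (g : G) → TangentSpace 𝓘(ℝ, E) g} {g : G}
    (hW : MDifferentiableAt 𝓘(ℝ, E) 𝓘(ℝ, E).tangent
      (fun g : G => (⟨g, W g⟩ : TangentBundle 𝓘(ℝ, E) G)) g) :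
    HasMFDerivAt (M' := E) 𝓘(ℝ, E) 𝓘(ℝ, E) (fun h => maurerCartan h (W h)) g
      (mfderiv (M' := E) 𝓘(ℝ, E) 𝓘(ℝ, E) (fun h => maurerCartan h (W h)) g) :=
  MDifferentiableAt.hasMFDerivAt
    (((contMDiff_maurerCartan (E := E) (G := G)).mdifferentiable (by simp) _).comp g hW)

/-- As right invariant vector fields commute with the left invariant frame, only the derivative of
the coefficients of `W` contributes to the bracket. -/
lemma mlieBracket_rightInvariantField_eq {W : (g : G) → TangentSpace 𝓘(ℝ, E) g} {g : G}
    (hW : MDifferentiableAt 𝓘(ℝ, E) 𝓘(ℝ, E).tangent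
      (fun g : G => (⟨g, W g⟩ : TangentBundle 𝓘(ℝ, E) G)) g) (v : GroupLieAlgebra 𝓘(ℝ, E) G) :
    mlieBracket 𝓘(ℝ, E) W (rightInvariantField v) g =
      -mulInvariantVectorField (mfderiv (M' := E) 𝓘(ℝ, E) 𝓘(ℝ, E)
        (fun h => maurerCartan h (W h)) g (rightInvariantField v g) : E) g := by
  rw [mlieBracket_eq_of_maurerCartan (Module.finBasis ℝ (GroupLieAlgebra 𝓘(ℝ, E) G)) _
    (hasMFDerivAt_maurerCartan hW)]
  simp [mlieBracket_left_right]
  rfl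

lemma mlieBracket_mulInvariantVectorField_eq {W : (g : G) → TangentSpace 𝓘(ℝ, E) g} {g : G}
    (hW : MDifferentiableAt 𝓘(ℝ, E) 𝓘(ℝ, E).tangent
      (fun g : G => (⟨g, W g⟩ : TangentBundle 𝓘(ℝ, E) G)) g) (v : GroupLieAlgebra 𝓘(ℝ, E) G) :
    mlieBracket 𝓘(ℝ, E) W (mulInvariantVectorField v) g =
      -mulInvariantVectorField (mfderiv (M' := E) 𝓘(ℝ, E) 𝓘(ℝ, E)
        (fun h => maurerCartan h (W h)) g (mulInvariantVectorField v g) : E) g +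
      mulInvariantVectorField ⁅maurerCartan g (W g), v⁆ g := by
  have := FiniteDimensional.complete ℝ E
  set b := Module.finBasis ℝ (GroupLieAlgebra 𝓘(ℝ, E) G)
  rw [mlieBracket_eq_of_maurerCartan b _ (hasMFDerivAt_maurerCartan hW)]
  congr 1
  conv_rhs => rw [← b.sum_repr (maurerCartan g (W g))]
  rw [← leftInvariantCLM_apply, sum_lie, map_sum]
  refine Finset.sum_congr rfl fun i _ => ?_
  rw [smul_lie, map_smul, leftInvariantCLM_apply, GroupLieAlgebra.bracket_def,
    mulInvariantVector_mlieBracket]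

/-- On a connected group, a vector field that commutes with all right invariant vector fields is
left invariant. -/
lemma eq_mulInvariantVectorField_of_mlieBracket_eq_zero [ConnectedSpace G]
    {W : (g : G) → TangentSpace 𝓘(ℝ, E) g}
    (hW : MDifferentiable 𝓘(ℝ, E) 𝓘(ℝ, E).tangent
      (fun g : G => (⟨g, W g⟩ : TangentBundle 𝓘(ℝ, E) G)))
    (h : ∀ v g, mlieBracket 𝓘(ℝ, E) W (rightInvariantField v) g = 0) (g : G) :
    W g = mulInvariantVectorField (W 1) g := by
  have hc := eq_of_mfderiv_eq_zero (M := G) (E := E) (F := E)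
    (f := fun h => maurerCartan h (W h))
    (fun g => (hasMFDerivAt_maurerCartan (hW g)).mdifferentiableAt) (fun g w => by
      obtain ⟨v, rfl⟩ : ∃ v, rightInvariantField v g = w := by
        refine ⟨(mfderiv 𝓘(ℝ, E) 𝓘(ℝ, E) (fun x : G => x * g⁻¹) g w : E), ?_⟩
        refine (mfderiv_mul_right_congr (E := E) rfl (mul_inv_cancel g).symm _).trans ?_
        refine (mfderiv_mul_right_mul_right (E := E) g⁻¹ g g w).trans ?_
        exact (mfderiv_mul_right_congr (E := E) (inv_mul_cancel g) rfl _).trans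
          (mfderiv_mul_one (E := E) g w)
      have h3 := h v g
      rw [mlieBracket_rightInvariantField_eq (hW g), neg_eq_zero] at h3
      have h4 := congrArg (maurerCartan g) h3
      exact (maurerCartan_mulInvariantVectorField g _).symm.trans (h4.trans (map_zero _))) g 1
  have hc' : maurerCartan g (W g) = W 1 := Eq.trans hc (maurerCartan_one _)
  rw [← hc', mulInvariantVectorField_maurerCartan]

end Brackets

/-! ### Linear vector fields and their left readings -/

section LieAlgebra
variable (E : Type*) [NormedAddCommGroup E] [NormedSpace ℝ E] [FiniteDimensional ℝ E]
  (G : Type*) [TopologicalSpace G] [ChartedSpace E G] [Group G] [LieGroup 𝓘(ℝ, E) ∞ G]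

/-- The Lie bracket of the Lie algebra of `G`, as a continuous bilinear map on the model space `E`,
which, unlike the Lie algebra, carries a norm. -/
def lieCLM : E →L[ℝ] E →L[ℝ] E :=
  have := FiniteDimensional.complete ℝ E
  LinearMap.toContinuousLinearMap ((LinearMap.toContinuousLinearMap (𝕜 := ℝ) (E := E)
    (F' := E)).toLinearMap ∘ₗ (LinearMap.mk₂ ℝ
      (fun a b : E =>
        @Bracket.bracket (GroupLieAlgebra 𝓘(ℝ, E) G) (GroupLieAlgebra 𝓘(ℝ, E) G) _ a b)
      (fun a b c => add_lie (L := GroupLieAlgebra 𝓘(ℝ, E) G) (M := GroupLieAlgebra 𝓘(ℝ, E) G) a b c)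
      (fun r a b => smul_lie (L := GroupLieAlgebra 𝓘(ℝ, E) G)
        (M := GroupLieAlgebra 𝓘(ℝ, E) G) r a b)
      (fun a b c => lie_add (L := GroupLieAlgebra 𝓘(ℝ, E) G) (M := GroupLieAlgebra 𝓘(ℝ, E) G) a b c)
      (fun r a b => lie_smul (L := GroupLieAlgebra 𝓘(ℝ, E) G)
        (M := GroupLieAlgebra 𝓘(ℝ, E) G) r a b)))

end LieAlgebra

section LinearFields
open VectorField
variable {E : Type*} [NormedAddCommGroup E] [NormedSpace ℝ E] [FiniteDimensional ℝ E]
  {G : Type*} [TopologicalSpace G] [ChartedSpace E G] [Group G] [LieGroup 𝓘(ℝ, E) ∞ G]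
  {X : (g : G) → TangentSpace 𝓘(ℝ, E) g}

lemma mfderiv_mul_right_comp_inv (b g : G) :
    (mfderiv 𝓘(ℝ, E) 𝓘(ℝ, E) (fun x : G => x * b) g : E →L[ℝ] E).comp
      (mfderiv 𝓘(ℝ, E) 𝓘(ℝ, E) (fun x : G => x * b⁻¹) (g * b)) = ContinuousLinearMap.id ℝ E := by
  refine ContinuousLinearMap.ext fun w => ?_
  refine (mfderiv_mul_right_congr (E := E) rfl (mul_inv_cancel_right g b).symm _).trans ?_
  refine (mfderiv_mul_right_mul_right (E := E) b⁻¹ b (g * b) w).trans ?_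
  exact (mfderiv_mul_right_congr (E := E) (inv_mul_cancel b) rfl _).trans
    (mfderiv_mul_one (E := E) (g * b) w)

lemma mfderiv_mul_right_inv_comp (b g : G) :
    (mfderiv 𝓘(ℝ, E) 𝓘(ℝ, E) (fun x : G => x * b⁻¹) (g * b) : E →L[ℝ] E).comp
      (mfderiv 𝓘(ℝ, E) 𝓘(ℝ, E) (fun x : G => x * b) g) = ContinuousLinearMap.id ℝ E := by
  refine ContinuousLinearMap.ext fun w => ?_
  refine (mfderiv_mul_right_mul_right (E := E) b b⁻¹ g w).trans ?_
  exact (mfderiv_mul_right_congr (E := E) (mul_inv_cancel b) rfl _).trans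
    (mfderiv_mul_one (E := E) g w)

lemma isInvertible_mfderiv_mul_right (b g : G) :
    (mfderiv 𝓘(ℝ, E) 𝓘(ℝ, E) (fun x : G => x * b) g).IsInvertible :=
  ContinuousLinearMap.IsInvertible.of_inverse (mfderiv_mul_right_comp_inv (E := E) b g)
    (mfderiv_mul_right_inv_comp (E := E) b g)

lemma inverse_mfderiv_mul_right (b g : G) :
    (mfderiv 𝓘(ℝ, E) 𝓘(ℝ, E) (fun x : G => x * b) g).inverse =
      mfderiv 𝓘(ℝ, E) 𝓘(ℝ, E) (fun x : G => x * b⁻¹) (g * b) :=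
  ContinuousLinearMap.inverse_eq (mfderiv_mul_right_comp_inv (E := E) b g)
    (mfderiv_mul_right_inv_comp (E := E) b g)

lemma mfderiv_mul_right_mpullback (W : (g : G) → TangentSpace 𝓘(ℝ, E) g) (a b : G) :
    mfderiv 𝓘(ℝ, E) 𝓘(ℝ, E) (fun x : G => x * b) a
      (mpullback 𝓘(ℝ, E) 𝓘(ℝ, E) (fun x : G => x * b) W a) = W (a * b) := by
  rw [mpullback_apply, inverse_mfderiv_mul_right]
  refine (mfderiv_mul_right_congr (E := E) rfl (mul_inv_cancel_right a b).symm _).trans ?_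
  refine (mfderiv_mul_right_mul_right (E := E) b⁻¹ b (a * b) _).trans ?_
  exact (mfderiv_mul_right_congr (E := E) (inv_mul_cancel b) rfl _).trans
    (mfderiv_mul_one (E := E) (a * b) _)

lemma mpullback_mul_right_rightInvariantField (b : G) (v : GroupLieAlgebra 𝓘(ℝ, E) G) :
    mpullback 𝓘(ℝ, E) 𝓘(ℝ, E) (fun x : G => x * b) (rightInvariantField v) =
      rightInvariantField v := by
  ext g
  rw [mpullback_apply, inverse_mfderiv_mul_right]
  have h := mfderiv_mul_right_rightInvariantField b⁻¹ (g * b) v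
  rw [mul_inv_cancel_right] at h
  exact h

/-- A linear vector field satisfies the product rule: the difference of its pullback by a right
translation with itself commutes with all right invariant vector fields, so that this difference is
left invariant. -/
lemma IsLinearVectorField.map_mul [ConnectedSpace G] (hX : IsLinearVectorField X) (a b : G) :
    X (a * b) = mfderiv 𝓘(ℝ, E) 𝓘(ℝ, E) (fun x : G => x * b) a (X a) +
      mfderiv 𝓘(ℝ, E) 𝓘(ℝ, E) (fun x : G => a * x) b (X b) := by
  have := FiniteDimensional.complete ℝ E
  have hXd : MDifferentiable 𝓘(ℝ, E) 𝓘(ℝ, E).tangent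
      (fun g : G => (⟨g, X g⟩ : TangentBundle 𝓘(ℝ, E) G)) := hX.smooth.mdifferentiable (by simp)
  set P := mpullback 𝓘(ℝ, E) 𝓘(ℝ, E) (fun x : G => x * b) X with hP
  have hPd : MDifferentiable 𝓘(ℝ, E) 𝓘(ℝ, E).tangent
      (fun g : G => (⟨g, P g⟩ : TangentBundle 𝓘(ℝ, E) G)) := by
    refine MDifferentiable.mpullback_vectorField (n := ∞) hXd contMDiff_mul_right (fun g => ?_)
      (WithTop.coe_le_coe.2 (le_top : (2 : ℕ∞) ≤ ⊤))
    exact isInvertible_mfderiv_mul_right b g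
  set W : (g : G) → TangentSpace 𝓘(ℝ, E) g := P - X with hW
  have hWd : MDifferentiable 𝓘(ℝ, E) 𝓘(ℝ, E).tangent
      (fun g : G => (⟨g, W g⟩ : TangentBundle 𝓘(ℝ, E) G)) := mdifferentiable_sub_section hPd hXd
  have hPW : P = W + X := by rw [hW, sub_add_cancel]
  have hbr : ∀ v g, mlieBracket 𝓘(ℝ, E) W (rightInvariantField v) g = 0 := by
    intro v g
    obtain ⟨w, hw⟩ := hX.normalizes v
    have h1 := mpullback_mlieBracket (n := ∞) (I := 𝓘(ℝ, E)) (I' := 𝓘(ℝ, E)) (x₀ := g)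
      (f := fun x : G => x * b) (V := X) (W := rightInvariantField v)
      (hXd _) (mdifferentiable_rightInvariantField v _)
      contMDiff_mul_right.contMDiffAt minSmoothness_two_le_infty
    rw [hw, mpullback_mul_right_rightInvariantField, mpullback_mul_right_rightInvariantField,
      ← hP, hPW, mlieBracket_add_left (hWd g) (hXd g), hw] at h1
    exact right_eq_add.1 h1
  have hWa := eq_mulInvariantVectorField_of_mlieBracket_eq_zero hWd hbr a
  have hW1 : W 1 = P 1 := by
    rw [hW, Pi.sub_apply, hX.map_one, sub_zero]
  have e1 := mfderiv_mul_right_mpullback X a b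
  rw [← hP, hPW, Pi.add_apply, hWa, hW1, map_add, add_comm] at e1
  rw [← e1]
  congr 1
  have e2 := mfderiv_mul_right_mpullback X 1 b
  rw [← hP] at e2
  refine Eq.trans ?_ ((mfderiv_mul_left_mul_right (E := E) a b 1 (P 1)).symm.trans ?_)
  · exact mfderiv_mul_right_congr (E := E) rfl (mul_one a).symm _
  · refine (congrArg (mfderiv 𝓘(ℝ, E) 𝓘(ℝ, E) (fun x : G => a * x) (1 * b)) e2).trans ?_
    have : ∀ c, c = b → (mfderiv 𝓘(ℝ, E) 𝓘(ℝ, E) (fun x : G => a * x) c (X c) : E) =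
        mfderiv 𝓘(ℝ, E) 𝓘(ℝ, E) (fun x : G => a * x) b (X b) := by rintro c rfl; rfl
    exact this _ (one_mul b)

/-- The pullback of a linear vector field by a left translation differs from it by a right invariant
vector field. -/
lemma mpullback_mul_left_eq_add_rightInvariantField (hX : IsLinearVectorField X) [ConnectedSpace G] (a : G) :
    mpullback 𝓘(ℝ, E) 𝓘(ℝ, E) (fun x : G => a * x) X =
      X + rightInvariantField (maurerCartan a (X a)) := by
  ext b
  rw [mpullback_apply, inverse_mfderiv_mul_left, hX.map_mul a b]
  refine (map_add (mfderiv 𝓘(ℝ, E) 𝓘(ℝ, E) (fun x : G => a⁻¹ * x) (a * b)) _ _).trans ?_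
  refine (add_comm _ _).trans (congrArg₂ (fun x y : E => x + y) ?_ ?_)
  · refine (mfderiv_mul_left_mul_left (E := E) a⁻¹ a b (X b)).trans ?_
    exact (mfderiv_mul_left_congr (E := E) (inv_mul_cancel a) rfl _).trans
      (mfderiv_one_mul (E := E) b _)
  · refine (mfderiv_mul_left_mul_right (E := E) a⁻¹ b a (X a)).trans ?_
    exact mfderiv_mul_right_congr (E := E) rfl (inv_mul_cancel a) _

/-- The bracket of a linear vector field with a left invariant vector field is
the left invariant vector field given by the associated derivation, just as for right invariant
vector fields: the pullback by a left translation changes the linear field by a right invariant one,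
which commutes with left invariant ones, and so reduces the claim to the identity. -/
lemma mlieBracket_mulInvariantVectorField (hX : IsLinearVectorField X) [ConnectedSpace G]
    (v : GroupLieAlgebra 𝓘(ℝ, E) G) (g : G) :
    mlieBracket 𝓘(ℝ, E) X (mulInvariantVectorField v) g =
      -mulInvariantVectorField (assocDerivation X v) g := by
  have := FiniteDimensional.complete ℝ E
  have hXd : MDifferentiable 𝓘(ℝ, E) 𝓘(ℝ, E).tangent
      (fun g : G => (⟨g, X g⟩ : TangentBundle 𝓘(ℝ, E) G)) := hX.smooth.mdifferentiable (by simp)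
  have h1 := mpullback_mlieBracket (n := ∞) (I := 𝓘(ℝ, E)) (I' := 𝓘(ℝ, E)) (x₀ := (1 : G))
    (f := fun x : G => g * x) (V := X) (W := mulInvariantVectorField v)
    (hXd _) (mdifferentiableAt_mulInvariantVectorField v)
    contMDiff_mul_left.contMDiffAt minSmoothness_two_le_infty
  rw [mpullback_mulInvariantVectorField, mpullback_mul_left_eq_add_rightInvariantField hX,
    mlieBracket_add_left (hXd _) (mdifferentiable_rightInvariantField _ _),
    mlieBracket_swap_apply (V := rightInvariantField _), mlieBracket_left_right, neg_zero,
    add_zero, mpullback_apply, inverse_mfderiv_mul_left, mul_one] at h1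
  -- at the identity, where `X` vanishes, the bracket only depends on the value of the other field
  have h2 : mlieBracket 𝓘(ℝ, E) X (mulInvariantVectorField v) (1 : G) = -assocDerivation X v := by
    rw [assocDerivation, neg_neg, mlieBracket_mulInvariantVectorField_eq (hXd 1),
      mlieBracket_rightInvariantField_eq (hXd 1), hX.map_one, map_zero, zero_lie,
      mulInvariantVectorField_one, mulInvariantVectorField_one, rightInvariantField_one]
    simp
  have h3 : maurerCartan g (mlieBracket 𝓘(ℝ, E) X (mulInvariantVectorField v) g) =
      -assocDerivation X v := Eq.trans h1 h2
  rw [← mulInvariantVectorField_maurerCartan g (mlieBracket 𝓘(ℝ, E) X _ g), h3]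
  exact map_neg (leftInvariantCLM g) _

/-- A vector field, read in the Lie algebra by left translations. Its values are regarded as elements
of the model space, where they can be differentiated. -/
def leftReading (X : (g : G) → TangentSpace 𝓘(ℝ, E) g) (g : G) : E :=
  maurerCartan g (X g)

lemma hasMFDerivAt_leftReading (hX : IsLinearVectorField X) (g : G) :
    HasMFDerivAt 𝓘(ℝ, E) 𝓘(ℝ, E) (leftReading X) g
      (mfderiv 𝓘(ℝ, E) 𝓘(ℝ, E) (leftReading X) g) :=
  hasMFDerivAt_maurerCartan (hX.smooth.mdifferentiable (by simp) g)

/-- The derivation associated with a linear vector field, as a continuous linear map on the model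
space: it is the derivative at the identity of the left reading. -/
def derivationCLM (X : (g : G) → TangentSpace 𝓘(ℝ, E) g) : E →L[ℝ] E :=
  mfderiv 𝓘(ℝ, E) 𝓘(ℝ, E) (leftReading X) (1 : G)

lemma derivationCLM_apply (hX : IsLinearVectorField X) (v : GroupLieAlgebra 𝓘(ℝ, E) G) :
    derivationCLM X v = (assocDerivation X v : E) := by
  rw [assocDerivation, mlieBracket_rightInvariantField_eq (hX.smooth.mdifferentiable (by simp) 1),
    rightInvariantField_one, neg_neg]
  exact (mulInvariantVectorField_one _).symm

lemma leftReading_one (hX : IsLinearVectorField X) : leftReading X (1 : G) = 0 := by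
  rw [leftReading, hX.map_one]
  exact map_zero (maurerCartan (1 : G))

/-- Two expressions for the bracket of `X` with the left invariant vector field of `v` agree: the one
in the left invariant frame, and the one given by the associated derivation. -/
lemma mfderiv_leftReading (hX : IsLinearVectorField X) [ConnectedSpace G]
    (v : GroupLieAlgebra 𝓘(ℝ, E) G) (g : G) :
    (mfderiv 𝓘(ℝ, E) 𝓘(ℝ, E) (leftReading X) g (mulInvariantVectorField v g) : E) =
      derivationCLM X v + lieCLM E G (leftReading X g) v := by
  have hXd : MDifferentiable 𝓘(ℝ, E) 𝓘(ℝ, E).tangent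
      (fun g : G => (⟨g, X g⟩ : TangentBundle 𝓘(ℝ, E) G)) := hX.smooth.mdifferentiable (by simp)
  have h1 := mlieBracket_mulInvariantVectorField_eq (hXd g) v
  rw [mlieBracket_mulInvariantVectorField hX] at h1
  have h2 := congrArg (maurerCartan g) h1
  rw [map_add, map_neg, map_neg, maurerCartan_mulInvariantVectorField] at h2
  have h3 : ∀ x y z : GroupLieAlgebra 𝓘(ℝ, E) G, -x = -y + z → y = x + z := fun x y z h => by
    rw [← neg_inj, neg_add, h]; abel
  refine Eq.trans ?_ (congrArg (fun z : E => z + lieCLM E G (leftReading X g) v)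
    (derivationCLM_apply hX v).symm)
  exact h3 _ _ _ (h2.trans (congrArg₂
    (fun z w : GroupLieAlgebra 𝓘(ℝ, E) G => -z + w)
    (maurerCartan_mulInvariantVectorField g _) (maurerCartan_mulInvariantVectorField g _)))

end LinearFields

/-! ### The left reading on subgroups -/

section Derivation
variable {E : Type*} [NormedAddCommGroup E] [NormedSpace ℝ E] [FiniteDimensional ℝ E]
  {G : Type*} [TopologicalSpace G] [ChartedSpace E G] [Group G] [LieGroup 𝓘(ℝ, E) ∞ G]
  {X : (g : G) → TangentSpace 𝓘(ℝ, E) g}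

/-- Along a curve with left velocity `y`, the left reading `f` of a linear vector field satisfies
`f' = 𝒟 y + ⁅f, y⁆`. -/
lemma hasDerivWithinAt_leftReading (hX : IsLinearVectorField X) [ConnectedSpace G]
    {γ : ℝ → G} {s : Set ℝ} {t : ℝ} {y : E}
    (hγ : HasMFDerivWithinAt 𝓘(ℝ, ℝ) 𝓘(ℝ, E) γ s t ((1 : ℝ →L[ℝ] ℝ).smulRight
      (mulInvariantVectorField (y : GroupLieAlgebra 𝓘(ℝ, E) G) (γ t)))) :
    HasDerivWithinAt (fun r => leftReading X (γ r))
      (derivationCLM X y + lieCLM E G (leftReading X (γ t)) y) s t := by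
  have h := (hasMFDerivAt_leftReading hX (γ t)).comp_hasMFDerivWithinAt t hγ
  have h2 : HasDerivWithinAt (fun r => leftReading X (γ r)) _ s t :=
    HasFDerivWithinAt.hasDerivWithinAt (𝕜 := ℝ) (F := E) h.hasFDerivWithinAt
  refine h2.congr_deriv ?_
  refine Eq.trans ?_ (mfderiv_leftReading hX (y : GroupLieAlgebra 𝓘(ℝ, E) G) (γ t))
  exact congrArg (mfderiv 𝓘(ℝ, E) 𝓘(ℝ, E) (leftReading X) (γ t)) (one_smul ℝ _)

end Derivation

section Homs
variable {E : Type*} [NormedAddCommGroup E] [NormedSpace ℝ E] [FiniteDimensional ℝ E]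
  {G : Type*} [TopologicalSpace G] [ChartedSpace E G] [Group G] [LieGroup 𝓘(ℝ, E) ∞ G]
  {F : Type*} [NormedAddCommGroup F] [NormedSpace ℝ F]
  {K : Type*} [TopologicalSpace K] [ChartedSpace F K] [Group K] [LieGroup 𝓘(ℝ, F) ∞ K]
  {X : (g : G) → TangentSpace 𝓘(ℝ, E) g}

/-- The derivative at the identity of a homomorphism of Lie groups, with values regarded as elements
of the model space of `G`. -/
def homDeriv (f : K →* G) : GroupLieAlgebra 𝓘(ℝ, F) K →L[ℝ] E :=
  mfderiv 𝓘(ℝ, F) 𝓘(ℝ, E) f (1 : K)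

/-- A homomorphism maps left invariant vector fields to left invariant vector fields. -/
lemma mfderiv_hom_mulInvariantVectorField {f : K →* G} (hf : ContMDiff 𝓘(ℝ, F) 𝓘(ℝ, E) ∞ f)
    (v : GroupLieAlgebra 𝓘(ℝ, F) K) (k : K) :
    mfderiv 𝓘(ℝ, F) 𝓘(ℝ, E) f k (mulInvariantVectorField v k) =
      mulInvariantVectorField (homDeriv (E := E) f v : GroupLieAlgebra 𝓘(ℝ, E) G) (f k) := by
  have hd : MDifferentiable 𝓘(ℝ, F) 𝓘(ℝ, E) f := hf.mdifferentiable (by simp)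
  have h := mfderiv_comp_apply (I := 𝓘(ℝ, F)) (I' := 𝓘(ℝ, F)) (I'' := 𝓘(ℝ, E)) (1 : K)
    (hd (k * 1)) (mdifferentiableAt_mul_left (E := F) k 1) v
  have h' := mfderiv_comp_apply (I := 𝓘(ℝ, F)) (I' := 𝓘(ℝ, E)) (I'' := 𝓘(ℝ, E)) (1 : K)
    (mdifferentiableAt_mul_left (E := E) (f k) (f 1)) (hd 1) v
  have e : (f : K → G) ∘ (fun x => k * x) = (fun x => f k * x) ∘ (f : K → G) := by
    ext x; simp
  rw [e] at h
  have e1 : ∀ (k' : K) (w : F), k' = k → (mfderiv 𝓘(ℝ, F) 𝓘(ℝ, E) f k' w : E) =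
      mfderiv 𝓘(ℝ, F) 𝓘(ℝ, E) f k w := by rintro _ w rfl; rfl
  refine (e1 _ _ (mul_one k)).symm.trans (h.symm.trans (h'.trans ?_))
  exact mfderiv_mul_left_congr (E := E) rfl (map_one f) _

lemma HasMFDerivWithinAt.hom_comp {f : K →* G} (hf : ContMDiff 𝓘(ℝ, F) 𝓘(ℝ, E) ∞ f)
    {c : ℝ → K} {s : Set ℝ} {t : ℝ} {y : GroupLieAlgebra 𝓘(ℝ, F) K}
    (hc : HasMFDerivWithinAt 𝓘(ℝ, ℝ) 𝓘(ℝ, F) c s t ((1 : ℝ →L[ℝ] ℝ).smulRight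
      (mulInvariantVectorField y (c t)))) :
    HasMFDerivWithinAt 𝓘(ℝ, ℝ) 𝓘(ℝ, E) (fun r => f (c r)) s t ((1 : ℝ →L[ℝ] ℝ).smulRight
      (mulInvariantVectorField (homDeriv (E := E) f y : GroupLieAlgebra 𝓘(ℝ, E) G) (f (c t)))) := by
  have h1 := (hf.mdifferentiable (by simp) (c t)).hasMFDerivAt.comp_hasMFDerivWithinAt t hc
  refine HasMFDerivWithinAt.congr_mfderiv h1 (ContinuousLinearMap.ext fun (r : ℝ) => ?_)
  refine (map_smul (mfderiv 𝓘(ℝ, F) 𝓘(ℝ, E) f (c t)) r _).trans ?_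
  exact congrArg (fun z : E => r • z) (mfderiv_hom_mulInvariantVectorField hf y (c t))

/-- A smooth curve in a Lie group has a continuous left velocity. -/
lemma exists_left_velocity {c : ℝ → K} (hc : ContMDiff 𝓘(ℝ, ℝ) 𝓘(ℝ, F) ∞ c) :
    ∃ y : ℝ → F, Continuous y ∧ ∀ t, HasMFDerivAt 𝓘(ℝ, ℝ) 𝓘(ℝ, F) c t
      ((1 : ℝ →L[ℝ] ℝ).smulRight
        (mulInvariantVectorField (y t : GroupLieAlgebra 𝓘(ℝ, F) K) (c t))) := by
  let τ : ℝ → TangentBundle 𝓘(ℝ, ℝ) ℝ := fun t => ⟨t, (1 : ℝ)⟩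
  have hτ : ContMDiff 𝓘(ℝ, ℝ) 𝓘(ℝ, ℝ).tangent ∞ τ :=
    contMDiff_vectorSpace_iff_contDiff.2 contDiff_const
  have h1 : ContMDiff 𝓘(ℝ, ℝ) 𝓘(ℝ, F).tangent ∞ (fun t => tangentMap 𝓘(ℝ, ℝ) 𝓘(ℝ, F) c (τ t)) :=
    (hc.contMDiff_tangentMap (by simp)).comp hτ
  refine ⟨fun t => maurerCartan (c t) (mfderiv 𝓘(ℝ, ℝ) 𝓘(ℝ, F) c t (1 : ℝ)),
    ((contMDiff_maurerCartan (E := F) (G := K)).comp h1).continuous, fun t => ?_⟩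
  refine (hc.mdifferentiable (by simp) t).hasMFDerivAt.congr_mfderiv ?_
  refine ContinuousLinearMap.ext fun (r : ℝ) => ?_
  rw [mulInvariantVectorField_maurerCartan]
  refine Eq.trans ?_ (map_smul (mfderiv 𝓘(ℝ, ℝ) 𝓘(ℝ, F) c t) r (1 : ℝ))
  simp
  rfl

/-- There is a linear projection of `E` with kernel `V`. -/
lemma exists_projection (V : Submodule ℝ E) :
    ∃ p : E →L[ℝ] E, (∀ x, p x = 0 ↔ x ∈ V) ∧ ∀ x, x - p x ∈ V := by
  obtain ⟨s, hs⟩ := V.mkQ.exists_rightInverse_of_surjective (by simp)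
  have hs' : ∀ x, V.mkQ (s (V.mkQ x)) = V.mkQ x := fun x => congrArg (fun T => T (V.mkQ x)) hs
  refine ⟨LinearMap.toContinuousLinearMap (s ∘ₗ V.mkQ), fun x => ⟨fun h => ?_, fun h => ?_⟩,
    fun x => ?_⟩
  · have h' : s (V.mkQ x) = 0 := h
    have := hs' x
    rw [h', map_zero] at this
    simpa using this.symm
  · have : V.mkQ x = 0 := by simpa using h
    simp [this]
  · have : V.mkQ (x - s (V.mkQ x)) = 0 := by rw [map_sub, hs', sub_self]
    exact (Submodule.Quotient.mk_eq_zero V).1 this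

/-- If `𝒟` maps the image `𝔥` of the Lie algebra of the connected group `K` into an ideal `𝔫` of
`𝔥`, then the left reading of the linear vector field takes values in `𝔫` on the image of `K`:
modulo `𝔫`, it satisfies a homogeneous linear differential equation along every curve of `K`. -/
lemma leftReading_mem (hX : IsLinearVectorField X) [ConnectedSpace G] [ConnectedSpace K]
    {f : K →* G} (hf : ContMDiff 𝓘(ℝ, F) 𝓘(ℝ, E) ∞ f)
    {𝔥 𝔫 : LieSubalgebra ℝ (GroupLieAlgebra 𝓘(ℝ, E) G)}
    (hfh : ∀ v : GroupLieAlgebra 𝓘(ℝ, F) K, homDeriv (E := E) f v ∈ 𝔥)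
    (h_ideal : ∀ x ∈ 𝔥, ∀ y ∈ 𝔫, ⁅x, y⁆ ∈ 𝔫)
    (hD : ∀ x ∈ 𝔥, assocDerivation X x ∈ 𝔫) (k : K) : leftReading X (f k) ∈ 𝔫 := by
  suffices h : {k | leftReading X (f k) ∈ 𝔫} = univ from
    (h ▸ mem_univ k : k ∈ {k | leftReading X (f k) ∈ 𝔫})
  refine eq_univ_of_smooth_curve (E := F) ⟨1, ?_⟩ fun c hc h0 => ?_
  · change leftReading X (f 1) ∈ 𝔫
    rw [map_one, leftReading_one hX]
    exact 𝔫.zero_mem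
  obtain ⟨y, hy, hcy⟩ := exists_left_velocity hc
  obtain ⟨p, hp, hp'⟩ := exists_projection (E := E) (𝔫.toSubmodule : Submodule ℝ E)
  -- `p` has kernel `𝔫`, so that `p (leftReading X (f (c t)))` has to vanish
  set z : ℝ → E := fun t => homDeriv (E := E) f (y t) with hz
  have hzc : Continuous z := (homDeriv (E := E) f).continuous.comp hy
  have hγ : ∀ t, HasDerivAt (fun r => leftReading X (f (c r)))
      (derivationCLM X (z t) + lieCLM E G (leftReading X (f (c t))) (z t)) t := fun t => by
    rw [← hasDerivWithinAt_univ]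
    exact hasDerivWithinAt_leftReading hX (γ := fun r => f (c r))
      (HasMFDerivWithinAt.hom_comp hf (hcy t).hasMFDerivWithinAt)
  obtain ⟨C, hC⟩ := isCompact_Icc.exists_bound_of_continuousOn (s := Icc (0 : ℝ) 1)
    hzc.continuousOn
  have hpd : ∀ t, HasDerivAt (fun r => p (leftReading X (f (c r))))
      (p (lieCLM E G (p (leftReading X (f (c t)))) (z t))) t := fun t => by
    refine (p.hasFDerivAt.comp_hasDerivAt t (hγ t)).congr_deriv ?_
    have hzt : (z t : GroupLieAlgebra 𝓘(ℝ, E) G) ∈ 𝔥 := hfh _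
    have e1 : p (derivationCLM X (z t)) = 0 := by
      rw [hp]
      refine Eq.mpr (congrArg (· ∈ 𝔫) (derivationCLM_apply hX (z t))) ?_
      exact hD _ hzt
    have e2 : p (lieCLM E G (leftReading X (f (c t)) - p (leftReading X (f (c t)))) (z t)) = 0 := by
      rw [hp]
      have h1 : ∀ u ∈ 𝔫, ∀ w ∈ 𝔥, ⁅u, w⁆ ∈ 𝔫 := fun u hu w hw => by
        rw [← lie_skew]
        exact 𝔫.neg_mem (h_ideal _ hw _ hu)
      exact h1 _ (hp' (leftReading X (f (c t)))) _ hzt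
    rw [map_add, e1, zero_add]
    rw [map_sub, sub_apply, map_sub, sub_eq_zero] at e2
    exact e2
  have h1 := eq_zero_of_abs_deriv_le_mul_abs_self_of_eq_zero_right (a := 0) (b := 1)
    (f := fun r => p (leftReading X (f (c r)))) (K := ‖p‖ * ‖lieCLM E G‖ * C)
    (fun t _ => (hpd t).continuousAt.continuousWithinAt)
    (fun t _ => (hpd t).hasDerivWithinAt) ((hp _).2 h0) (fun t ht => by
      calc _ ≤ ‖p‖ * (‖lieCLM E G‖ * ‖p (leftReading X (f (c t)))‖ * ‖z t‖) :=
            (p.le_opNorm _).trans (mul_le_mul_of_nonneg_left (ContinuousLinearMap.le_opNorm₂ _ _ _)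
              (norm_nonneg _))
        _ ≤ ‖p‖ * (‖lieCLM E G‖ * ‖p (leftReading X (f (c t)))‖ * C) := by
            gcongr
            exact hC t (Ico_subset_Icc_self ht)
        _ = _ := by ring) 1 (by simp)
  exact (hp _).1 h1

end Homs

/-! ### Curves with prescribed left velocity -/

section Development

/-- A property of intervals that holds for all small intervals near each point and is stable under
concatenation holds for all intervals. -/
lemma interval_induction {P : ℝ → ℝ → Prop} {a b : ℝ} (hab : a ≤ b)
    (hloc : ∀ t ∈ Icc a b, ∃ ε > 0, ∀ c d, a ≤ c → c ≤ d → d ≤ b → t - ε < c → d < t + ε → P c d)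
    (hglue : ∀ c d e, a ≤ c → c ≤ d → d ≤ e → e ≤ b → P c d → P d e → P c e) : P a b := by
  choose ε hε hP using hloc
  obtain ⟨t, ht0, hmono, ⟨m, hm⟩, hsub⟩ := exists_monotone_Icc_subset_open_cover_Icc hab
    (c := fun x : Icc a b => {y : Icc a b | (y : ℝ) ∈ Ioo (x - ε x x.2) (x + ε x x.2)})
    (fun x => isOpen_Ioo.preimage continuous_subtype_val)
    (fun y _ => mem_iUnion.2 ⟨y, by have := hε y y.2; constructor <;> linarith⟩)
  have hstep : ∀ n, P (t n) (t (n + 1)) := fun n => by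
    obtain ⟨x, hx⟩ := hsub n
    have hle : t n ≤ t (n + 1) := hmono (Nat.le_succ n)
    have h1 := hx (left_mem_Icc.2 hle)
    have h2 := hx (right_mem_Icc.2 hle)
    exact hP x x.2 _ _ (t n).2.1 hle (t (n + 1)).2.2 h1.1 h2.2
  have hall : ∀ n, P (t 0) (t (n + 1)) := fun n => by
    induction n with
    | zero => exact hstep 0
    | succ n ih =>
      exact hglue _ _ _ (t 0).2.1 (hmono (Nat.zero_le _)) (hmono (Nat.le_succ _)) (t _).2.2 ih
        (hstep _)
  have := hall m
  rwa [ht0, hm (m + 1) (Nat.le_succ m)] at this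

variable {F : Type*} [NormedAddCommGroup F] [NormedSpace ℝ F]
  {K : Type*} [TopologicalSpace K] [ChartedSpace F K] [Group K] [LieGroup 𝓘(ℝ, F) ∞ K]

/-- On the set `s`, the curve `c` in a Lie group has left velocity `y`. -/
def HasLeftVelocityOn (y : ℝ → F) (c : ℝ → K) (s : Set ℝ) : Prop :=
  ∀ t ∈ s, HasMFDerivWithinAt 𝓘(ℝ, ℝ) 𝓘(ℝ, F) c s t ((1 : ℝ →L[ℝ] ℝ).smulRight
    (mulInvariantVectorField (y t : GroupLieAlgebra 𝓘(ℝ, F) K) (c t)))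

lemma HasLeftVelocityOn.mono {y : ℝ → F} {c : ℝ → K} {s s' : Set ℝ}
    (h : HasLeftVelocityOn y c s) (hs : s' ⊆ s) : HasLeftVelocityOn y c s' :=
  fun t ht => (h t (hs ht)).mono hs

lemma HasLeftVelocityOn.congr {y : ℝ → F} {c c' : ℝ → K} {s : Set ℝ}
    (h : HasLeftVelocityOn y c s) (hc : EqOn c' c s) : HasLeftVelocityOn y c' s := fun t ht => by
  have := (h t ht).congr_of_eventuallyEq (hc.eventuallyEq_of_mem self_mem_nhdsWithin) (hc ht)
  refine this.congr_mfderiv (ContinuousLinearMap.ext fun (r : ℝ) => ?_)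
  have e : ∀ k k' : K, k = k' →
      (leftInvariantCLM (E := F) k (y t : GroupLieAlgebra 𝓘(ℝ, F) K) : F) =
        leftInvariantCLM (E := F) k' (y t : GroupLieAlgebra 𝓘(ℝ, F) K) := by rintro k _ rfl; rfl
  exact congrArg (fun z : F => r • z) (e _ _ (hc ht).symm)

lemma HasLeftVelocityOn.const_mul {y : ℝ → F} {c : ℝ → K} {s : Set ℝ}
    (h : HasLeftVelocityOn y c s) (k : K) : HasLeftVelocityOn y (fun t => k * c t) s :=
  fun t ht => by
  have h1 := (mdifferentiableAt_mul_left (E := F) k (c t)).hasMFDerivAt.comp_hasMFDerivWithinAt t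
    (h t ht)
  refine HasMFDerivWithinAt.congr_mfderiv h1 (ContinuousLinearMap.ext fun (r : ℝ) => ?_)
  refine (map_smul (mfderiv 𝓘(ℝ, F) 𝓘(ℝ, F) (fun x : K => k * x) (c t)) r _).trans ?_
  exact congrArg (fun z : F => r • z)
    (mfderiv_mul_left_mulInvariantVectorField k (c t) (y t : GroupLieAlgebra 𝓘(ℝ, F) K))

lemma HasLeftVelocityOn.glue {y : ℝ → F} {n m : ℝ → K} {a b c : ℝ} (hab : a ≤ b) (hbc : b ≤ c)
    (hn : HasLeftVelocityOn y n (Icc a b)) (hm : HasLeftVelocityOn y m (Icc b c)) :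
    ∃ p : ℝ → K, HasLeftVelocityOn y p (Icc a c) := by
  set m' : ℝ → K := fun t => n b * (m b)⁻¹ * m t with hm'
  have hm2 : HasLeftVelocityOn y m' (Icc b c) := hm.const_mul _
  set p : ℝ → K := fun t => if t ≤ b then n t else m' t with hp
  have h1 : HasLeftVelocityOn y p (Icc a b) := hn.congr fun t ht => by simp [hp, ht.2]
  have h2 : HasLeftVelocityOn y p (Icc b c) := hm2.congr fun t ht => by
    rcases ht.1.eq_or_lt with rfl | h
    · simp [hp, hm']
    · simp [hp, not_le.2 h]
  refine ⟨p, fun t ht => ?_⟩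
  rcases lt_trichotomy t b with h | rfl | h
  · refine (h1 t ⟨ht.1, h.le⟩).mono_of_mem_nhdsWithin ?_
    filter_upwards [self_mem_nhdsWithin, nhdsWithin_le_nhds (Iio_mem_nhds h)] with r hr hr'
    exact ⟨hr.1, le_of_lt hr'⟩
  · rw [← Icc_union_Icc_eq_Icc hab hbc]
    exact (h1 t ⟨hab, le_rfl⟩).union (h2 t ⟨le_rfl, hbc⟩)
  · refine (h2 t ⟨h.le, ht.2⟩).mono_of_mem_nhdsWithin ?_
    filter_upwards [self_mem_nhdsWithin, nhdsWithin_le_nhds (Ioi_mem_nhds h)] with r hr hr'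
    exact ⟨le_of_lt hr', hr.2⟩

/-- Short time existence for curves in a Lie group with prescribed left velocity. -/
lemma exists_hasLeftVelocityOn_Ioo [CompleteSpace F] {y : ℝ → F} (hy : ContDiff ℝ ∞ y) (t₀ : ℝ) :
    ∃ ε > 0, ∃ c : ℝ → K, HasLeftVelocityOn y c (Ioo (t₀ - ε) (t₀ + ε)) := by
  set φ := extChartAt 𝓘(ℝ, F) (1 : K) with hφ
  -- time is added as a coordinate to obtain an autonomous equation in the chart
  set V : F × ℝ → F × ℝ := fun z =>
    (fderiv ℝ (localMul F K) (z.1, chartOne F K) (0, chartDeriv F K (y z.2)), 1) with hV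
  have hVd : ContDiffAt ℝ 1 V (chartOne F K, t₀) := by
    have h1 : ContDiffAt ℝ 1 (fderiv ℝ (localMul F K)) (chartOne F K, chartOne F K) :=
      (contDiffAt_localMul_right chartOne_mem_target).fderiv_right (by norm_cast)
    have h2 : ContDiffAt ℝ 1 (fun z : F × ℝ => fderiv ℝ (localMul F K) (z.1, chartOne F K))
        (chartOne F K, t₀) :=
      ContDiffAt.comp (f := fun z : F × ℝ => (z.1, chartOne F K)) (chartOne F K, t₀) h1
        (contDiffAt_fst.prodMk contDiffAt_const)
    have h3 : ContDiffAt ℝ 1 (fun z : F × ℝ => ((0 : F), (chartDeriv F K (y z.2) : F)))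
        (chartOne F K, t₀) := by
      refine contDiffAt_const.prodMk ?_
      have h4 : ContDiff ℝ 1 (fun z : F × ℝ => y z.2) :=
        (hy.of_le (by norm_cast)).comp contDiff_snd
      exact (ContinuousLinearMap.contDiff (𝕜 := ℝ) (E := F) (F := F)
        (chartDeriv F K)).contDiffAt.comp _ h4.contDiffAt
    exact (h2.clm_apply h3).prodMk contDiffAt_const
  obtain ⟨f, hf0, ε, hε, hf⟩ :=
    hVd.exists_forall_mem_closedBall_exists_eq_forall_mem_Ioo_hasDerivAt₀ t₀
  have hf2 : ∀ t ∈ Ioo (t₀ - ε) (t₀ + ε), (f t).2 = t := by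
    have hd : ∀ t ∈ Ioo (t₀ - ε) (t₀ + ε), HasDerivAt (fun t => (f t).2 - t) 0 t := fun t ht => by
      have h : HasDerivAt (fun t => (f t).2 - t) _ t :=
        ((ContinuousLinearMap.snd ℝ F ℝ).hasFDerivAt.comp_hasDerivAt t (hf t ht)).sub
          (hasDerivAt_id t)
      exact h.congr_deriv (by simp [hV])
    intro t ht
    have h := isOpen_Ioo.is_const_of_deriv_eq_zero (isPreconnected_Ioo)
      (fun s hs => (hd s hs).differentiableAt.differentiableWithinAt)
      (fun s hs => (hd s hs).deriv) ht (show t₀ ∈ Ioo (t₀ - ε) (t₀ + ε) by constructor <;> linarith)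
    simp only [hf0] at h
    linarith
  have hcont : ContinuousAt (fun t => (f t).1) t₀ :=
    (hf t₀ (by constructor <;> linarith)).continuousAt.fst
  have hnh : ∀ᶠ t in nhds t₀, (f t).1 ∈ φ.target := by
    refine hcont.eventually ?_
    simp only [hf0]
    exact (isOpen_extChartAt_target (1 : K)).mem_nhds chartOne_mem_target
  obtain ⟨δ, hδ, hball⟩ := Metric.eventually_nhds_iff.1 hnh
  refine ⟨min ε δ, lt_min hε hδ, fun t => φ.symm (f t).1, fun t ht => ?_⟩
  have ht1 : t ∈ Ioo (t₀ - ε) (t₀ + ε) :=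
    ⟨by linarith [ht.1, min_le_left ε δ], by linarith [ht.2, min_le_left ε δ]⟩
  have hx : (f t).1 ∈ φ.target := hball (by
    rw [Real.dist_eq, abs_lt]
    constructor <;> linarith [ht.1, ht.2, min_le_right ε δ])
  have hfd : HasFDerivAt (fun t => (f t).1) ((1 : ℝ →L[ℝ] ℝ).smulRight
      (fderiv ℝ (localMul F K) ((f t).1, chartOne F K) (0, chartDeriv F K (y t)))) t := by
    have h := (ContinuousLinearMap.fst ℝ F ℝ).hasFDerivAt.comp_hasDerivAt t (hf t ht1)
    simp only [hV, hf2 t ht1] at h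
    exact h.hasFDerivAt
  have hs := ((contMDiffAt_extChartAt_one_symm hx).mdifferentiableAt
    (by simp)).hasMFDerivAt.comp t hfd.hasMFDerivAt
  refine HasMFDerivWithinAt.congr_mfderiv hs.hasMFDerivWithinAt
    (ContinuousLinearMap.ext fun (r : ℝ) => ?_)
  refine (map_smul (mfderiv 𝓘(ℝ, F) 𝓘(ℝ, F) φ.symm (f t).1) r _).trans ?_
  exact congrArg (fun z : F => r • z)
    (mfderiv_symm_localMul_left hx (y t : GroupLieAlgebra 𝓘(ℝ, F) K))

/-- Curves in a Lie group with prescribed left velocity exist for all times, as left translations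
permute them: pieces that are short in time fit together. -/
lemma exists_hasLeftVelocityOn_Icc [CompleteSpace F] {y : ℝ → F} (hy : ContDiff ℝ ∞ y)
    {a b : ℝ} (hab : a ≤ b) : ∃ c : ℝ → K, c b = 1 ∧ HasLeftVelocityOn y c (Icc a b) := by
  obtain ⟨c, hc⟩ : ∃ c : ℝ → K, HasLeftVelocityOn y c (Icc a b) := by
    refine interval_induction (P := fun a b => ∃ c : ℝ → K, HasLeftVelocityOn y c (Icc a b)) hab
      (fun t _ => ?_) fun c d e _ hcd hde _ ⟨n, hn⟩ ⟨m, hm⟩ => hn.glue hcd hde hm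
    obtain ⟨ε, hε, c, hc⟩ := exists_hasLeftVelocityOn_Ioo (K := K) hy t
    exact ⟨ε, hε, fun u v _ _ _ hu hv => ⟨c, hc.mono fun r hr =>
      ⟨hu.trans_le hr.1, hr.2.trans_lt hv⟩⟩⟩
  exact ⟨fun t => (c b)⁻¹ * c t, by simp, hc.const_mul _⟩

end Development

/-! ### Integral curves in cosets -/

section IntegralCurves
variable {E : Type*} [NormedAddCommGroup E] [NormedSpace ℝ E] [FiniteDimensional ℝ E]
  {G : Type*} [TopologicalSpace G] [ChartedSpace E G] [Group G] [LieGroup 𝓘(ℝ, E) ∞ G]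
  {F : Type*} [NormedAddCommGroup F] [NormedSpace ℝ F]
  {K : Type*} [TopologicalSpace K] [ChartedSpace F K] [Group K] [LieGroup 𝓘(ℝ, F) ∞ K]
  {X : (g : G) → TangentSpace 𝓘(ℝ, E) g}

/-- A linear differential equation with constant coefficients has a smooth solution with prescribed
value at time `T`. -/
lemma exists_linear_solution [CompleteSpace F] (A : F →L[ℝ] F) (v : F) (T : ℝ) :
    ∃ z : ℝ → F, ContDiff ℝ ∞ z ∧ z T = v ∧ ∀ t, HasDerivAt z (A (z t)) t := by
  have hd : ∀ t, HasDerivAt (fun t : ℝ => NormedSpace.exp ((t - T) • A) v)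
      (A (NormedSpace.exp ((t - T) • A) v)) t := fun t => by
    have h1 : HasDerivAt (fun t : ℝ => NormedSpace.exp ((t - T) • A)) _ t :=
      HasDerivAt.comp_sub_const t T (hasDerivAt_exp_smul_const' A (t - T))
    exact ((ContinuousLinearMap.apply ℝ F v).hasFDerivAt.comp_hasDerivAt t h1)
  refine ⟨_, ?_, by simp, hd⟩
  have hn : ∀ n : ℕ, ContDiff ℝ n (fun t : ℝ => NormedSpace.exp ((t - T) • A) v) := fun n => by
    induction n with
    | zero => exact contDiff_zero.2 (continuous_iff_continuousAt.2 fun t => (hd t).continuousAt)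
    | succ n ih =>
      refine (contDiff_succ_iff_deriv (n := (n : WithTop ℕ∞))).2
        ⟨fun t => (hd t).differentiableAt, fun h => absurd h (by simp), ?_⟩
      rw [funext fun t => (hd t).deriv]
      exact A.contDiff.comp ih
  exact contDiff_infty.2 hn

/-- The integral curves of a linear vector field `X` through points `g` of `G` at which the left
reading of `X` belongs to a `𝒟`-invariant subalgebra `𝔫` stay in the left coset of `g` modulo
the Lie subgroup of `𝔫`, and they exist for all times. The left velocity of the curve is obtained
by solving the linear equation `y' = 𝒟 y`: along the curve with left velocity `y`, the left reading
`q` of `X` satisfies `q' = 𝒟 y + ⁅q, y⁆`, so that `q = y`. -/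
lemma exists_integralCurve_coset [FiniteDimensional ℝ F] (hX : IsLinearVectorField X)
    [ConnectedSpace G] {f : K →* G} (hf : ContMDiff 𝓘(ℝ, F) 𝓘(ℝ, E) ∞ f)
    (hinj : Function.Injective (homDeriv (F := F) (E := E) f))
    {𝔫 : LieSubalgebra ℝ (GroupLieAlgebra 𝓘(ℝ, E) G)}
    (hfn : ∀ v : GroupLieAlgebra 𝓘(ℝ, E) G, v ∈ 𝔫 ↔ ∃ w, homDeriv (F := F) (E := E) f w = v)
    (hD : ∀ x ∈ 𝔫, assocDerivation X x ∈ 𝔫) {g : G}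
    (hg : leftReading X g ∈ 𝔫) {T : ℝ} (hT : 0 ≤ T) :
    ∃ x : ℝ → G, x T = g ∧ (∀ t, ∃ k, x t = g * f k) ∧ ∀ t ∈ Icc 0 T,
      HasMFDerivWithinAt 𝓘(ℝ, ℝ) 𝓘(ℝ, E) x (Icc 0 T) t ((1 : ℝ →L[ℝ] ℝ).smulRight (X (x t))) := by
  have : CompleteSpace F := FiniteDimensional.complete ℝ F
  -- the linear equation is solved in the Lie algebra of `K`, which `ι` identifies with `𝔫`
  let ι : F →L[ℝ] E := homDeriv (F := F) (E := E) f
  obtain ⟨P, hP⟩ := LinearMap.exists_leftInverse_of_injective (ι : F →ₗ[ℝ] E)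
    (LinearMap.ker_eq_bot.2 hinj)
  have hP' : ∀ w, P (ι w) = w := fun w => congrArg (fun T => T w) hP
  have hιP : ∀ v : E, (v : GroupLieAlgebra 𝓘(ℝ, E) G) ∈ 𝔫 → ι (P v) = v := fun v hv => by
    obtain ⟨w, hw⟩ := (hfn v).1 hv
    have hw' : ι w = v := hw
    exact (congrArg ι ((congrArg P hw').symm.trans (hP' w))).trans hw'
  have hmem : ∀ w : F, ((ι w : E) : GroupLieAlgebra 𝓘(ℝ, E) G) ∈ 𝔫 := fun w => (hfn _).2 ⟨w, rfl⟩
  obtain ⟨z, hz, hzT, hzd⟩ := exists_linear_solution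
    ((LinearMap.toContinuousLinearMap P).comp ((derivationCLM X).comp ι)) (P (leftReading X g)) T
  have hyd : ∀ t, HasDerivAt (fun t => ι (z t)) (derivationCLM X (ι (z t))) t := fun t => by
    refine (ι.hasFDerivAt.comp_hasDerivAt t (hzd t)).congr_deriv ?_
    refine hιP _ ?_
    refine Eq.mpr (congrArg (· ∈ 𝔫) (derivationCLM_apply hX (ι (z t)))) ?_
    exact hD _ (hmem _)
  obtain ⟨c, hcT, hc⟩ := exists_hasLeftVelocityOn_Icc (K := K) hz hT
  set x : ℝ → G := fun t => g * f (c t) with hx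
  have hxT : x T = g := by simp [hx, hcT]
  have hxv : HasLeftVelocityOn (fun t => ι (z t)) x (Icc 0 T) :=
    HasLeftVelocityOn.const_mul (c := fun t => f (c t))
      (fun t ht => HasMFDerivWithinAt.hom_comp hf (hc t ht)) g
  have hq : ∀ t ∈ Icc 0 T, HasDerivWithinAt (fun r => leftReading X (x r))
      (derivationCLM X (ι (z t)) + lieCLM E G (leftReading X (x t)) (ι (z t))) (Icc 0 T) t :=
    fun t ht => hasDerivWithinAt_leftReading hX (hxv t ht)
  have hself : ∀ y : E, lieCLM E G y y = 0 := fun y => lie_self (L := GroupLieAlgebra 𝓘(ℝ, E) G) y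
  have hr : ∀ t ∈ Icc 0 T, HasDerivWithinAt (fun r => leftReading X (x r) - ι (z r))
      (lieCLM E G (leftReading X (x t) - ι (z t)) (ι (z t))) (Icc 0 T) t := fun t ht => by
    refine ((hq t ht).sub (hyd t).hasDerivWithinAt).congr_deriv ?_
    rw [map_sub, sub_apply, hself, sub_zero, add_sub_cancel_left]
  have hyc : Continuous fun t => ι (z t) := ι.continuous.comp hz.continuous
  obtain ⟨C, hC⟩ := isCompact_Icc.exists_bound_of_continuousOn (s := Icc (0 : ℝ) T)
    hyc.continuousOn
  have hC0 : 0 ≤ C := (norm_nonneg _).trans (hC 0 ⟨le_rfl, hT⟩)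
  have hzero := ODE_solution_unique_of_mem_Icc_left (a := 0) (b := T)
    (v := fun t r => lieCLM E G r (ι (z t))) (s := fun _ => univ)
    (K := ‖lieCLM E G‖₊ * C.toNNReal) (f := fun r => leftReading X (x r) - ι (z r))
    (g := fun _ => 0)
    (fun t ht => LipschitzOnWith.of_dist_le_mul fun u _ w _ => by
      rw [dist_eq_norm, dist_eq_norm, ← sub_apply, ← map_sub]
      refine ((lieCLM E G).le_opNorm₂ _ _).trans ?_
      rw [NNReal.coe_mul, coe_nnnorm, Real.coe_toNNReal C hC0, mul_right_comm]
      gcongr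
      exact hC t (Ioc_subset_Icc_self ht))
    (fun t ht => (hr t ht).continuousWithinAt)
    (fun t ht => (hr t (Ioc_subset_Icc_self ht)).mono_of_mem_nhdsWithin (by
      filter_upwards [self_mem_nhdsWithin, nhdsWithin_le_nhds (Ioi_mem_nhds ht.1)] with r h1 h2
      exact ⟨le_of_lt h2, (show r ≤ t from h1).trans ht.2⟩))
    (fun _ _ => mem_univ _) continuousOn_const
    (fun t _ => by simpa using hasDerivWithinAt_const t (Iic t) (0 : E))
    (fun _ _ => mem_univ _)
    (by
      simp only [hxT, hzT]
      exact sub_eq_zero.2 (hιP _ hg).symm)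
  refine ⟨x, hxT, fun t => ⟨c t, rfl⟩, fun t ht => ?_⟩
  have hqy : ι (z t) = leftReading X (x t) := (sub_eq_zero.1 (hzero ht)).symm
  refine (hxv t ht).congr_mfderiv (ContinuousLinearMap.ext fun (r : ℝ) => ?_)
  exact congrArg (fun w : E => r • w)
    ((congrArg (fun y : E => (leftInvariantCLM (x t) (y : GroupLieAlgebra 𝓘(ℝ, E) G) : E))
      hqy).trans (mulInvariantVectorField_maurerCartan (x t) (X (x t))))

end IntegralCurves

/-! ### Absolutely continuous functions -/

section AbsoluteContinuity
open AbsolutelyContinuousOnInterval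

variable {V W : Type*} [PseudoMetricSpace V] [PseudoMetricSpace W]

lemma absolutelyContinuousOnInterval_congr {f g : ℝ → V} {a b : ℝ} (hab : a ≤ b)
    (hf : AbsolutelyContinuousOnInterval f a b) (h : EqOn f g (Icc a b)) :
    AbsolutelyContinuousOnInterval g a b := by
  rw [absolutelyContinuousOnInterval_iff] at hf ⊢
  intro ε hε
  obtain ⟨δ, hδ, H⟩ := hf ε hε
  refine ⟨δ, hδ, fun I hI hlen => ?_⟩
  have hI1 := hI.1
  rw [uIcc_of_le hab] at hI1
  refine lt_of_eq_of_lt (Finset.sum_congr rfl fun i hi => ?_) (H I hI hlen)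
  rw [h (hI1 i hi).1, h (hI1 i hi).2]

lemma absolutelyContinuousOnInterval_lipschitz_comp {f : ℝ → V} {a b : ℝ} (hab : a ≤ b)
    (hf : AbsolutelyContinuousOnInterval f a b) {ψ : V → W} {s : Set V} {C : NNReal}
    (hψ : LipschitzOnWith C ψ s) (hs : MapsTo f (Icc a b) s) :
    AbsolutelyContinuousOnInterval (fun t => ψ (f t)) a b := by
  rw [absolutelyContinuousOnInterval_iff] at hf ⊢
  intro ε hε
  obtain ⟨δ, hδ, H⟩ := hf (ε / (C + 1)) (by positivity)
  refine ⟨δ, hδ, fun I hI hlen => ?_⟩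
  have hI1 := hI.1
  rw [uIcc_of_le hab] at hI1
  calc _ ≤ ∑ i ∈ Finset.range I.1, C * dist (f (I.2 i).1) (f (I.2 i).2) :=
        Finset.sum_le_sum fun i hi => hψ.dist_le_mul _ (hs (hI1 i hi).1) _ (hs (hI1 i hi).2)
    _ = C * ∑ i ∈ Finset.range I.1, dist (f (I.2 i).1) (f (I.2 i).2) := Finset.mul_sum _ _ _ |>.symm
    _ ≤ C * (ε / (C + 1)) := by gcongr; exact (H I hI hlen).le
    _ < (C + 1) * (ε / (C + 1)) := by gcongr; linarith
    _ = ε := by field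

lemma absolutelyContinuousOnInterval_prodMk {f : ℝ → V} {g : ℝ → W} {a b : ℝ}
    (hf : AbsolutelyContinuousOnInterval f a b) (hg : AbsolutelyContinuousOnInterval g a b) :
    AbsolutelyContinuousOnInterval (fun t => (f t, g t)) a b := by
  rw [absolutelyContinuousOnInterval_iff] at hf hg ⊢
  intro ε hε
  obtain ⟨δ, hδ, H⟩ := hf (ε / 2) (by positivity)
  obtain ⟨δ', hδ', H'⟩ := hg (ε / 2) (by positivity)
  refine ⟨min δ δ', lt_min hδ hδ', fun I hI hlen => ?_⟩
  have h1 := H I hI (hlen.trans_le (min_le_left _ _))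
  have h2 := H' I hI (hlen.trans_le (min_le_right _ _))
  calc _ ≤ ∑ i ∈ Finset.range I.1, (dist (f (I.2 i).1) (f (I.2 i).2) +
        dist (g (I.2 i).1) (g (I.2 i).2)) := Finset.sum_le_sum fun i _ => by
          rw [Prod.dist_eq]
          exact max_le_add_of_nonneg dist_nonneg dist_nonneg
    _ < ε := by rw [Finset.sum_add_distrib]; linarith

lemma absolutelyContinuousOnInterval_comp_sub {f : ℝ → V} {a b : ℝ} (s : ℝ)
    (hf : AbsolutelyContinuousOnInterval f (a - s) (b - s)) :
    AbsolutelyContinuousOnInterval (fun t => f (t - s)) a b := by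
  rw [absolutelyContinuousOnInterval_iff] at hf ⊢
  intro ε hε
  obtain ⟨δ, hδ, H⟩ := hf ε hε
  refine ⟨δ, hδ, fun I hI hlen => ?_⟩
  refine H (I.1, fun i => ((I.2 i).1 - s, (I.2 i).2 - s)) ⟨fun i hi => ?_, ?_⟩ (by simpa using hlen)
  · have := hI.1 i hi
    simp only [mem_uIcc] at this ⊢
    grind
  · intro i hi j hj hij
    have := hI.2 hi hj hij
    simp only [Function.onFun, Set.disjoint_left, mem_uIoc] at this ⊢
    intro r hr hr'
    exact this (a := r + s) (by grind) (by grind)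

/-- Absolutely continuous pieces fit together: cut every interval at the common end point. -/
lemma absolutelyContinuousOnInterval_glue {f : ℝ → V} {a b c : ℝ} (hab : a ≤ b) (hbc : b ≤ c)
    (h1 : AbsolutelyContinuousOnInterval f a b) (h2 : AbsolutelyContinuousOnInterval f b c) :
    AbsolutelyContinuousOnInterval f a c := by
  rw [absolutelyContinuousOnInterval_iff] at h1 h2 ⊢
  intro ε hε
  obtain ⟨δ, hδ, H⟩ := h1 (ε / 2) (by positivity)
  obtain ⟨δ', hδ', H'⟩ := h2 (ε / 2) (by positivity)
  refine ⟨min δ δ', lt_min hδ hδ', fun I hI hlen => ?_⟩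
  have hI1 := hI.1
  rw [uIcc_of_le (hab.trans hbc)] at hI1
  have e1 := H (I.1, fun i => (min (I.2 i).1 b, min (I.2 i).2 b)) ⟨fun i hi => by
      have := hI1 i hi
      rw [uIcc_of_le hab]
      simp only [mem_Icc] at this ⊢
      grind, fun i hi j hj hij => by
      have := hI.2 hi hj hij
      simp only [Function.onFun, Set.disjoint_left, mem_uIoc] at this ⊢
      intro r hr hr'
      exact this (a := r) (by grind) (by grind)⟩
    (lt_of_le_of_lt (Finset.sum_le_sum fun i _ => by
      simp only [Real.dist_eq]
      exact (abs_min_sub_min_le_max _ _ _ _).trans (by simp)) (hlen.trans_le (min_le_left _ _)))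
  have e2 := H' (I.1, fun i => (max (I.2 i).1 b, max (I.2 i).2 b)) ⟨fun i hi => by
      have := hI1 i hi
      rw [uIcc_of_le hbc]
      simp only [mem_Icc] at this ⊢
      grind, fun i hi j hj hij => by
      have := hI.2 hi hj hij
      simp only [Function.onFun, Set.disjoint_left, mem_uIoc] at this ⊢
      intro r hr hr'
      exact this (a := r) (by grind) (by grind)⟩
    (lt_of_le_of_lt (Finset.sum_le_sum fun i _ => by
      simp only [Real.dist_eq]
      exact abs_max_sub_max_le_abs _ _ _) (hlen.trans_le (min_le_right _ _)))
  calc _ ≤ ∑ i ∈ Finset.range I.1, (dist (f (min (I.2 i).1 b)) (f (min (I.2 i).2 b)) +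
        dist (f (max (I.2 i).1 b)) (f (max (I.2 i).2 b))) := Finset.sum_le_sum fun i _ => by
          rcases le_total (I.2 i).1 b with h | h <;> rcases le_total (I.2 i).2 b with h' | h'
          · simp [h, h']
          · simpa [h, h'] using dist_triangle _ _ _
          · simpa [h, h', add_comm] using dist_triangle (f (I.2 i).1) (f b) (f (I.2 i).2)
          · simp [h, h']
    _ < ε := by rw [Finset.sum_add_distrib]; linarith

end AbsoluteContinuity

/-! ### Absolutely continuous curves in charts -/

section Charts
variable {E : Type*} [NormedAddCommGroup E] [NormedSpace ℝ E]
  {G : Type*} [TopologicalSpace G] [ChartedSpace E G]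

/-- The curve `γ` in the manifold `G` is continuous on `[a, b]` and absolutely continuous in charts
there. -/
def IsACCurve (γ : ℝ → G) (a b : ℝ) : Prop :=
  ContinuousOn γ (Icc a b) ∧ ∀ (x : G) (c d : ℝ), a ≤ c → c ≤ d → d ≤ b →
    MapsTo γ (Icc c d) (chartAt E x).source →
      AbsolutelyContinuousOnInterval (fun t => chartAt E x (γ t)) c d

/-- Absolute continuity in charts can be checked near every point of the interval. -/
lemma IsACCurve.of_local {γ : ℝ → G} {a b : ℝ} (hc : ContinuousOn γ (Icc a b))
    (h : ∀ x : G, ∀ t ∈ Icc a b, γ t ∈ (chartAt E x).source → ∃ ε > 0, ∀ c d, a ≤ c → c ≤ d →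
      d ≤ b → t - ε < c → d < t + ε → MapsTo γ (Icc c d) (chartAt E x).source →
      AbsolutelyContinuousOnInterval (fun t => chartAt E x (γ t)) c d) :
    IsACCurve (E := E) γ a b := by
  refine ⟨hc, fun x c d hac hcd hdb hm => ?_⟩
  refine interval_induction hcd (fun t ht => ?_) fun p q r _ hpq hqr _ h1 h2 =>
    absolutelyContinuousOnInterval_glue hpq hqr h1 h2
  obtain ⟨ε, hε, H⟩ := h x t ⟨hac.trans ht.1, ht.2.trans hdb⟩ (hm ht)
  exact ⟨ε, hε, fun p q hp hpq hq h1 h2 => H p q (hac.trans hp) hpq (hq.trans hdb) h1 h2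
    (hm.mono_left (Icc_subset_Icc hp hq))⟩

lemma IsACCurve.congr {γ γ' : ℝ → G} {a b : ℝ} (h : IsACCurve (E := E) γ a b)
    (he : EqOn γ γ' (Icc a b)) : IsACCurve (E := E) γ' a b := by
  refine ⟨h.1.congr he.symm, fun x c d hac hcd hdb hm => ?_⟩
  have hsub : Icc c d ⊆ Icc a b := Icc_subset_Icc hac hdb
  refine absolutelyContinuousOnInterval_congr hcd (h.2 x c d hac hcd hdb fun t ht => ?_)
    fun t ht => by rw [he (hsub ht)]
  rw [he (hsub ht)]
  exact hm ht

lemma IsACCurve.comp_sub {γ : ℝ → G} {a b : ℝ} (s : ℝ)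
    (h : IsACCurve (E := E) γ (a - s) (b - s)) : IsACCurve (E := E) (fun t => γ (t - s)) a b := by
  refine ⟨h.1.comp (by fun_prop) fun t ht => ⟨by linarith [ht.1], by linarith [ht.2]⟩,
    fun x c d hac hcd hdb hm => ?_⟩
  refine absolutelyContinuousOnInterval_comp_sub (f := fun t => chartAt E x (γ t)) s
    (h.2 x _ _ (by linarith) (by linarith) (by linarith) fun t ht => ?_)
  have := hm (x := t + s) ⟨by linarith [ht.1], by linarith [ht.2]⟩
  simpa using this

lemma IsACCurve.glue {γ : ℝ → G} {a b c : ℝ} (hab : a ≤ b) (hbc : b ≤ c)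
    (h1 : IsACCurve (E := E) γ a b) (h2 : IsACCurve (E := E) γ b c) :
    IsACCurve (E := E) γ a c := by
  refine ⟨?_, fun x p q hap hpq hqc hm => ?_⟩
  · rw [← Icc_union_Icc_eq_Icc hab hbc]
    exact h1.1.union_of_isClosed h2.1 isClosed_Icc isClosed_Icc
  rcases le_total q b with hq | hq
  · exact h1.2 x p q hap hpq hq hm
  rcases le_total b p with hp | hp
  · exact h2.2 x p q hp hpq hqc hm
  · exact absolutelyContinuousOnInterval_glue hp hq
      (h1.2 x p b hap hp le_rfl (hm.mono_left (Icc_subset_Icc le_rfl hq)))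
      (h2.2 x b q le_rfl hq hqc (hm.mono_left (Icc_subset_Icc hp le_rfl)))

/-- A continuous curve takes values in an open set near every time at which it does so. -/
lemma exists_forall_Icc_mem {γ : ℝ → G} {a b t : ℝ} (hc : ContinuousOn γ (Icc a b))
    (ht : t ∈ Icc a b) {u : Set G} (hu : u ∈ nhds (γ t)) :
    ∃ ε > 0, ∀ r, a ≤ r → r ≤ b → t - ε < r → r < t + ε → γ r ∈ u := by
  obtain ⟨ε, hε, h⟩ := Metric.mem_nhdsWithin_iff.1 (hc t ht hu)
  refine ⟨ε, hε, fun r h1 h2 h3 h4 => h ⟨?_, h1, h2⟩⟩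
  rw [Metric.mem_ball, Real.dist_eq, abs_lt]
  constructor <;> linarith

/-- Integral curves of a continuous vector field are absolutely continuous in charts. -/
lemma IsACCurve.of_hasMFDerivWithinAt [IsManifold 𝓘(ℝ, E) ∞ G]
    {X : (g : G) → TangentSpace 𝓘(ℝ, E) g}
    (hX : Continuous (fun g => (⟨g, X g⟩ : TangentBundle 𝓘(ℝ, E) G))) {x : ℝ → G} {a b : ℝ}
    (hx : ∀ t ∈ Icc a b, HasMFDerivWithinAt 𝓘(ℝ, ℝ) 𝓘(ℝ, E) x (Icc a b) t
      ((1 : ℝ →L[ℝ] ℝ).smulRight (X (x t)))) : IsACCurve (E := E) x a b := by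
  have : IsManifold 𝓘(ℝ, E) 1 G := IsManifold.of_le (n := ∞) (by norm_cast)
  have hc : ContinuousOn x (Icc a b) := fun t ht => (hx t ht).continuousWithinAt
  refine ⟨hc, fun z c d hac hcd hdb hm => ?_⟩
  have hsub : Icc c d ⊆ Icc a b := Icc_subset_Icc hac hdb
  set e := trivializationAt E (TangentSpace 𝓘(ℝ, E)) z with he
  have hcont : ContinuousOn (fun t => (e ⟨x t, X (x t)⟩).2) (Icc c d) := by
    refine continuous_snd.comp_continuousOn (e.continuousOn.comp
      (hX.comp_continuousOn (hc.mono hsub)) fun t ht => ?_)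
    rw [e.mem_source]
    simpa [he] using hm ht
  obtain ⟨C, hC⟩ := isCompact_Icc.exists_bound_of_continuousOn hcont
  have hd : ∀ t ∈ Icc c d, HasDerivWithinAt (fun t => chartAt E z (x t))
      (e ⟨x t, X (x t)⟩).2 (Icc c d) t := fun t ht => by
    have h1 : MDifferentiableAt 𝓘(ℝ, E) 𝓘(ℝ, E) (chartAt E z) (x t) :=
      mdifferentiableAt_atlas (chart_mem_atlas E z) (hm ht)
    have h2 := h1.hasMFDerivAt.comp_hasMFDerivWithinAt t ((hx t (hsub ht)).mono hsub)
    have h3 : HasDerivWithinAt (fun t => chartAt E z (x t)) _ (Icc c d) t :=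
      HasFDerivWithinAt.hasDerivWithinAt (𝕜 := ℝ) (F := E) h2.hasFDerivWithinAt
    refine h3.congr_deriv ?_
    have h4 : (mfderiv 𝓘(ℝ, E) 𝓘(ℝ, E) (chartAt E z) (x t) (X (x t)) : E) =
        (e ⟨x t, X (x t)⟩).2 := by
      have h5 := TangentBundle.continuousLinearMapAt_trivializationAt (I := 𝓘(ℝ, E)) (hm ht)
      have h6 := congrArg (fun T => T (X (x t))) h5
      refine Eq.trans ?_ (h6.symm.trans ?_)
      · simp
        rfl
      · exact Bundle.Trivialization.continuousLinearMapAt_apply_of_mem ℝ e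
          (by simpa [he] using hm ht) (X (x t))
    refine Eq.trans ?_ h4
    exact congrArg (mfderiv 𝓘(ℝ, E) 𝓘(ℝ, E) (chartAt E z) (x t)) (one_smul ℝ _)
  have hlip : LipschitzOnWith C.toNNReal (fun t => chartAt E z (x t)) (Icc c d) :=
    (convex_Icc c d).lipschitzOnWith_of_nnnorm_hasDerivWithin_le hd fun t ht => by
      rw [← NNReal.coe_le_coe, coe_nnnorm]
      exact (hC t ht).trans (Real.le_coe_toNNReal C)
  rw [← uIcc_of_le hcd] at hlip
  exact hlip.absolutelyContinuousOnInterval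

end Charts

section Product
variable {E : Type*} [NormedAddCommGroup E] [NormedSpace ℝ E]
  {G : Type*} [TopologicalSpace G] [ChartedSpace E G] [Group G] [LieGroup 𝓘(ℝ, E) ∞ G]

/-- Products of absolutely continuous curves in a Lie group are absolutely continuous, as the
multiplication is locally Lipschitz in charts. -/
lemma IsACCurve.mul {γ δ : ℝ → G} {a b : ℝ} (hγ : IsACCurve (E := E) γ a b)
    (hδ : IsACCurve (E := E) δ a b) : IsACCurve (E := E) (fun t => γ t * δ t) a b := by
  have hcont : ContinuousMul G := continuousMul_of_contMDiffMul 𝓘(ℝ, E) ∞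
  refine IsACCurve.of_local (hγ.1.mul hδ.1) fun z t ht hz => ?_
  set φ := chartAt E (γ t) with hφ
  set ψ := chartAt E (δ t) with hψ
  set M : E × E → E := fun p => chartAt E z (φ.symm p.1 * ψ.symm p.2) with hM
  have hMd : ContDiffAt ℝ 1 M (φ (γ t), ψ (δ t)) := by
    rw [← contMDiffAt_iff_contDiffAt]
    have s1 : ContMDiffAt 𝓘(ℝ, E) 𝓘(ℝ, E) ∞ φ.symm (φ (γ t)) := by
      simpa using (contMDiffOn_extChartAt_symm (I := 𝓘(ℝ, E)) (n := ∞) (γ t)).contMDiffAt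
        (extChartAt_target_mem_nhds (I := 𝓘(ℝ, E)) (γ t))
    have s2 : ContMDiffAt 𝓘(ℝ, E) 𝓘(ℝ, E) ∞ ψ.symm (ψ (δ t)) := by
      simpa using (contMDiffOn_extChartAt_symm (I := 𝓘(ℝ, E)) (n := ∞) (δ t)).contMDiffAt
        (extChartAt_target_mem_nhds (I := 𝓘(ℝ, E)) (δ t))
    have e1 : ContMDiffAt 𝓘(ℝ, E × E) 𝓘(ℝ, E) ∞ (fun p : E × E => φ.symm p.1)
        (φ (γ t), ψ (δ t)) := ContMDiffAt.comp (f := Prod.fst) (φ (γ t), ψ (δ t)) s1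
      contDiff_fst.contMDiff.contMDiffAt
    have e2 : ContMDiffAt 𝓘(ℝ, E × E) 𝓘(ℝ, E) ∞ (fun p : E × E => ψ.symm p.2)
        (φ (γ t), ψ (δ t)) := ContMDiffAt.comp (f := Prod.snd) (φ (γ t), ψ (δ t)) s2
      contDiff_snd.contMDiff.contMDiffAt
    refine (ContMDiffAt.comp (I' := 𝓘(ℝ, E)) (g := chartAt E z) _ ?_ (e1.mul e2)).of_le
      (by norm_cast)
    have := contMDiffAt_extChartAt' (I := 𝓘(ℝ, E)) (n := ∞) (x := z) (x' := γ t * δ t) hz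
    simpa [φ.left_inv (mem_chart_source E (γ t)), ψ.left_inv (mem_chart_source E (δ t))] using this
  obtain ⟨C, s, hs, hlip⟩ := hMd.exists_lipschitzOnWith
  have hγs := mem_chart_source E (γ t)
  have hδs := mem_chart_source E (δ t)
  have hcts : ContinuousWithinAt (fun r => (φ (γ r), ψ (δ r))) (Icc a b) t :=
    ((φ.continuousAt hγs).comp_continuousWithinAt (hγ.1 t ht)).prodMk
      ((ψ.continuousAt hδs).comp_continuousWithinAt (hδ.1 t ht))
  obtain ⟨ε₁, hε₁, h₁⟩ := exists_forall_Icc_mem hγ.1 ht (φ.open_source.mem_nhds hγs)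
  obtain ⟨ε₂, hε₂, h₂⟩ := exists_forall_Icc_mem hδ.1 ht (ψ.open_source.mem_nhds hδs)
  obtain ⟨ε₃, hε₃, h₃⟩ := Metric.mem_nhdsWithin_iff.1 (hcts hs)
  refine ⟨min ε₁ (min ε₂ ε₃), by positivity, fun c d hac hcd hdb hc hd _ => ?_⟩
  have hmem : ∀ r ∈ Icc c d, γ r ∈ φ.source ∧ δ r ∈ ψ.source ∧ (φ (γ r), ψ (δ r)) ∈ s := by
    intro r hr
    have e1 : a ≤ r := hac.trans hr.1
    have e2 : r ≤ b := hr.2.trans hdb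
    have e3 : t - min ε₁ (min ε₂ ε₃) < r := hc.trans_le hr.1
    have e4 : r < t + min ε₁ (min ε₂ ε₃) := hr.2.trans_lt hd
    have l1 := min_le_left ε₁ (min ε₂ ε₃)
    have l2 := (min_le_right ε₁ (min ε₂ ε₃)).trans (min_le_left ε₂ ε₃)
    have l3 := (min_le_right ε₁ (min ε₂ ε₃)).trans (min_le_right ε₂ ε₃)
    refine ⟨h₁ r e1 e2 (by linarith) (by linarith), h₂ r e1 e2 (by linarith) (by linarith),
      h₃ ⟨?_, e1, e2⟩⟩
    rw [Metric.mem_ball, Real.dist_eq, abs_lt]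
    constructor <;> linarith
  have hAC := absolutelyContinuousOnInterval_lipschitz_comp hcd
    (absolutelyContinuousOnInterval_prodMk
      (hγ.2 (γ t) c d hac hcd hdb fun r hr => (hmem r hr).1)
      (hδ.2 (δ t) c d hac hcd hdb fun r hr => (hmem r hr).2.1)) hlip
    fun r hr => (hmem r hr).2.2
  refine absolutelyContinuousOnInterval_congr hcd hAC fun r hr => ?_
  simp only [hM]
  rw [φ.left_inv (hmem r hr).1, ψ.left_inv (hmem r hr).2.1]

end Product

/-! ### Solutions of the linear system -/

section Solutions
variable {E : Type*} [NormedAddCommGroup E] [NormedSpace ℝ E]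
  {G : Type*} [TopologicalSpace G] [ChartedSpace E G] [Group G]
  {m : ℕ} {X : (g : G) → TangentSpace 𝓘(ℝ, E) g} {B : Fin m → GroupLieAlgebra 𝓘(ℝ, E) G}

lemma IsSolutionOn.isACCurve {u : ℝ → Fin m → ℝ} {T : ℝ} {γ : ℝ → G}
    (h : IsSolutionOn X B u T γ) : IsACCurve (E := E) γ 0 T :=
  ⟨h.continuousOn, h.absolutelyContinuous⟩

/-- If the curves `γ` and `γ'` agree near `t` and `γ'` is differentiable at `t`, with derivative
prescribed by a vector field, then so is `γ`. -/
lemma hasMFDerivAt_congr_field {Y : (g : G) → TangentSpace 𝓘(ℝ, E) g} {γ γ' : ℝ → G} {t : ℝ}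
    (h : HasMFDerivAt 𝓘(ℝ, ℝ) 𝓘(ℝ, E) γ' t ((1 : ℝ →L[ℝ] ℝ).smulRight (Y (γ' t))))
    (he : γ =ᶠ[nhds t] γ') :
    HasMFDerivAt 𝓘(ℝ, ℝ) 𝓘(ℝ, E) γ t ((1 : ℝ →L[ℝ] ℝ).smulRight (Y (γ t))) := by
  have e : ∀ g g' : G, g = g' → (Y g : E) = Y g' := by rintro g _ rfl; rfl
  exact (h.congr_of_eventuallyEq he).congr_mfderiv (ContinuousLinearMap.ext fun (r : ℝ) =>
    congrArg (fun z : E => r • z) (e _ _ he.eq_of_nhds.symm))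

/-- The field of the control system for a constant value of the control. -/
def systemField (X : (g : G) → TangentSpace 𝓘(ℝ, E) g) (B : Fin m → GroupLieAlgebra 𝓘(ℝ, E) G)
    (w : Fin m → ℝ) (g : G) : TangentSpace 𝓘(ℝ, E) g :=
  X g + ∑ j, w j • rightInvariantField (B j) g

lemma IsSolutionOn.concat {u₁ u₂ u : ℝ → Fin m → ℝ} {T₁ T₂ : ℝ} (hT₁ : 0 ≤ T₁) (hT₂ : 0 ≤ T₂)
    {γ₁ γ₂ : ℝ → G} (h₁ : IsSolutionOn X B u₁ T₁ γ₁) (h₂ : IsSolutionOn X B u₂ T₂ γ₂)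
    (h : γ₁ T₁ = γ₂ 0) (hu₁ : ∀ t ∈ Ioo 0 T₁, u t = u₁ t)
    (hu₂ : ∀ t ∈ Ioo T₁ (T₁ + T₂), u t = u₂ (t - T₁)) :
    ∃ γ, IsSolutionOn X B u (T₁ + T₂) γ ∧ γ 0 = γ₁ 0 ∧ γ (T₁ + T₂) = γ₂ T₂ := by
  set γ : ℝ → G := fun t => if t ≤ T₁ then γ₁ t else γ₂ (t - T₁) with hγ
  have e₁ : EqOn γ₁ γ (Icc 0 T₁) := fun t ht => by simp [hγ, ht.2]
  have e₂ : EqOn (fun t => γ₂ (t - T₁)) γ (Icc T₁ (T₁ + T₂)) := fun t ht => by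
    rcases ht.1.eq_or_lt with rfl | h'
    · simp [hγ, h]
    · simp [hγ, not_le.2 h']
  have hac₁ : IsACCurve (E := E) γ 0 T₁ := h₁.isACCurve.congr e₁
  have hac₂ : IsACCurve (E := E) γ T₁ (T₁ + T₂) := by
    refine IsACCurve.congr (IsACCurve.comp_sub T₁ ?_) e₂
    simpa using h₂.isACCurve
  have hac := hac₁.glue hT₁ (by linarith) hac₂
  refine ⟨γ, ⟨hac.1, hac.2, ?_⟩, (e₁ ⟨le_rfl, hT₁⟩).symm, ?_⟩
  · have hshift : ∀ᵐ t : ℝ, t - T₁ ∈ Ioo 0 T₂ → HasMFDerivAt 𝓘(ℝ, ℝ) 𝓘(ℝ, E) γ₂ (t - T₁)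
        ((1 : ℝ →L[ℝ] ℝ).smulRight (systemField X B (u₂ (t - T₁)) (γ₂ (t - T₁)))) :=
      (measurePreserving_sub_right volume T₁).quasiMeasurePreserving.ae h₂.ae_hasMFDerivAt
    filter_upwards [h₁.ae_hasMFDerivAt, hshift, Measure.ae_ne volume T₁] with t ht₁ ht₂ hne ht
    rcases lt_or_gt_of_ne hne with hlt | hgt
    · have ht' : t ∈ Ioo 0 T₁ := ⟨ht.1, hlt⟩
      refine hasMFDerivAt_congr_field (Y := systemField X B (u t)) (γ' := γ₁) ?_ ?_
      · rw [hu₁ t ht']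
        exact ht₁ ht'
      · filter_upwards [Ioo_mem_nhds ht.1 hlt] with r hr using (e₁ (Ioo_subset_Icc_self hr)).symm
    · have ht' : t ∈ Ioo T₁ (T₁ + T₂) := ⟨hgt, ht.2⟩
      refine hasMFDerivAt_congr_field (Y := systemField X B (u t)) (γ' := fun t => γ₂ (t - T₁))
        ?_ ?_
      · rw [hu₂ t ht']
        have hs : HasMFDerivAt 𝓘(ℝ, ℝ) 𝓘(ℝ, ℝ) (fun r : ℝ => r - T₁) t
            (ContinuousLinearMap.id ℝ ℝ) := ((hasFDerivAt_id t).sub_const T₁).hasMFDerivAt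
        have := (ht₂ ⟨by linarith [ht'.1], by linarith [ht'.2]⟩).comp t hs
        exact this
      · filter_upwards [Ioo_mem_nhds hgt ht.2] with r hr using (e₂ (Ioo_subset_Icc_self hr)).symm
  · rw [← e₂ ⟨by linarith, le_rfl⟩]
    simp

/-- Points that are reachable from reachable points are reachable. -/
lemma reachableSet_trans {Ω : Set (Fin m → ℝ)} {U : Set (ℝ → Fin m → ℝ)}
    (hU : IsControlClass Ω U) {g h k : G} (hh : h ∈ reachableSet X B U g)
    (hk : k ∈ reachableSet X B U h) : k ∈ reachableSet X B U g := by
  simp only [reachableSet, mem_iUnion, mem_Ioi, reachableAt, mem_ofPred_eq, exists_prop] at hh hk ⊢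
  obtain ⟨T₁, hT₁, u₁, hu₁, γ₁, hγ₁, rfl, rfl⟩ := hh
  obtain ⟨T₂, hT₂, u₂, hu₂, γ₂, hγ₂, h20, rfl⟩ := hk
  obtain ⟨u, hu, e₁, e₂⟩ := hU.concat_mem u₁ hu₁ u₂ hu₂ T₁ T₂ hT₁ hT₂
  obtain ⟨γ, hγ, hγ0, hγT⟩ := hγ₁.concat hT₁.le hT₂.le hγ₂ h20.symm e₁ e₂
  exact ⟨T₁ + T₂, by positivity, u, hu, γ, hγ, hγ0, hγT⟩

end Solutions

section Translate
variable {E : Type*} [NormedAddCommGroup E] [NormedSpace ℝ E] [FiniteDimensional ℝ E]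
  {G : Type*} [TopologicalSpace G] [ChartedSpace E G] [Group G] [LieGroup 𝓘(ℝ, E) ∞ G]
  {m : ℕ} {X : (g : G) → TangentSpace 𝓘(ℝ, E) g} {B : Fin m → GroupLieAlgebra 𝓘(ℝ, E) G}

/-- A solution of the linear system, multiplied from the right by an integral curve of the linear
vector field, is a solution for the same control. -/
lemma IsSolutionOn.mul_integralCurve [ConnectedSpace G] (hX : IsLinearVectorField X)
    {u : ℝ → Fin m → ℝ} {T : ℝ} {γ x : ℝ → G} (h : IsSolutionOn X B u T γ)
    (hx : ∀ t ∈ Icc 0 T, HasMFDerivWithinAt 𝓘(ℝ, ℝ) 𝓘(ℝ, E) x (Icc 0 T) t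
      ((1 : ℝ →L[ℝ] ℝ).smulRight (X (x t)))) : IsSolutionOn X B u T (fun t => γ t * x t) := by
  have hac := h.isACCurve.mul (IsACCurve.of_hasMFDerivWithinAt hX.smooth.continuous hx)
  refine ⟨hac.1, hac.2, ?_⟩
  filter_upwards [h.ae_hasMFDerivAt] with t ht htT
  have h1 := hasMFDerivWithinAt_univ.2 (ht htT)
  have h2 := hasMFDerivWithinAt_univ.2
    ((hx t (Ioo_subset_Icc_self htT)).hasMFDerivAt (Icc_mem_nhds htT.1 htT.2))
  have h3 := HasMFDerivWithinAt.curve_mul h1 h2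
  refine (hasMFDerivWithinAt_univ.1 h3).congr_mfderiv (ContinuousLinearMap.ext fun (r : ℝ) => ?_)
  refine congrArg (fun z : E => r • z) ?_
  set R := mfderiv 𝓘(ℝ, E) 𝓘(ℝ, E) (fun z : G => z * x t) (γ t) with hR
  have e1 : R (X (γ t) + ∑ j, u t j • rightInvariantField (B j) (γ t)) =
      R (X (γ t)) + ∑ j, u t j • R (rightInvariantField (B j) (γ t)) := by
    rw [map_add, map_sum]
    simp only [map_smul]
  have e2 : ∀ j, (R (rightInvariantField (B j) (γ t)) : E) =
      rightInvariantField (B j) (γ t * x t) := fun j =>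
    mfderiv_mul_right_rightInvariantField (x t) (γ t) (B j)
  let p : E := R (X (γ t))
  let q : E := mfderiv 𝓘(ℝ, E) 𝓘(ℝ, E) (fun z : G => γ t * z) (x t) (X (x t))
  have e3 : (X (γ t * x t) : E) = p + q := hX.map_mul (γ t) (x t)
  have e4 : ((∑ j, u t j • R (rightInvariantField (B j) (γ t)) : TangentSpace 𝓘(ℝ, E) (γ t * x t)) : E) =
      ((∑ j, u t j • rightInvariantField (B j) (γ t * x t) :
        TangentSpace 𝓘(ℝ, E) (γ t * x t)) : E) :=
    Finset.sum_congr rfl fun j _ => congrArg (fun z : E => u t j • z) (e2 j)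
  refine (congrArg (fun z : E => z + q) e1).trans ?_
  refine Eq.trans ?_ (congrArg₂ (fun z w : E => z + w) e3.symm e4)
  exact add_right_comm (G := E) _ _ _

/-- Right translation by `g` preserves the reachable set if the integral curve of the linear vector
field through `g` stays in the reachable set for negative times: a point of the form `a * g` is
reached by first steering to the point of this curve from which the flow needs the time of `a`
to arrive at `g`. -/
lemma mul_mem_reachableSet [ConnectedSpace G] (hX : IsLinearVectorField X)
    {Ω : Set (Fin m → ℝ)} {U : Set (ℝ → Fin m → ℝ)} (hU : IsControlClass Ω U) {g : G}
    (hg : ∀ T : ℝ, 0 ≤ T → ∃ x : ℝ → G, x T = g ∧ x 0 ∈ reachableSet X B U 1 ∧ ∀ t ∈ Icc 0 T,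
      HasMFDerivWithinAt 𝓘(ℝ, ℝ) 𝓘(ℝ, E) x (Icc 0 T) t ((1 : ℝ →L[ℝ] ℝ).smulRight (X (x t))))
    {a : G} (ha : a ∈ reachableSet X B U 1) : a * g ∈ reachableSet X B U 1 := by
  have ha' := ha
  simp only [reachableSet, mem_iUnion, mem_Ioi, reachableAt, mem_ofPred_eq, exists_prop] at ha'
  obtain ⟨T, hT, u, hu, γ, hγ, hγ0, rfl⟩ := ha'
  obtain ⟨x, rfl, hx0, hx⟩ := hg T hT.le
  refine reachableSet_trans hU hx0 ?_
  simp only [reachableSet, mem_iUnion, mem_Ioi, reachableAt, mem_ofPred_eq, exists_prop]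
  exact ⟨T, hT, u, hu, _, hγ.mul_integralCurve hX hx, by simp [hγ0], rfl⟩

end Translate

/-! ### Reachability of subgroups -/

section Reachability

/-- An open submonoid of a connected topological group is the whole group. -/
lemma mem_of_isOpen_of_mul_mem {K : Type*} [TopologicalSpace K] [Group K] [IsTopologicalGroup K]
    [ConnectedSpace K] {S : Set K} (hS : IsOpen S) (h1 : 1 ∈ S)
    (hmul : ∀ a ∈ S, ∀ b ∈ S, a * b ∈ S) (k : K) : k ∈ S := by
  let L : Subgroup K :=
    { carrier := S ∩ S⁻¹
      mul_mem' := fun {a b} ha hb => ⟨hmul a ha.1 b hb.1, by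
        rw [Set.mem_inv, mul_inv_rev]
        exact hmul _ hb.2 _ ha.2⟩
      one_mem' := ⟨h1, by simpa using h1⟩
      inv_mem' := fun {a} ha => ⟨ha.2, by simpa using ha.1⟩ }
  have hopen : IsOpen (L : Set K) := hS.inter hS.inv
  have huniv : (L : Set K) = univ :=
    IsClopen.eq_univ ⟨L.isClosed_of_isOpen hopen, hopen⟩ ⟨1, L.one_mem⟩
  have : k ∈ (L : Set K) := huniv ▸ mem_univ k
  exact this.1

variable {E : Type*} [NormedAddCommGroup E] [NormedSpace ℝ E] [FiniteDimensional ℝ E]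
  {G : Type*} [TopologicalSpace G] [ChartedSpace E G] [Group G] [LieGroup 𝓘(ℝ, E) ∞ G]
  {F : Type*} [NormedAddCommGroup F] [NormedSpace ℝ F]
  {K : Type*} [TopologicalSpace K] [ChartedSpace F K] [Group K] [LieGroup 𝓘(ℝ, F) ∞ K]
  {F' : Type*} [NormedAddCommGroup F'] [NormedSpace ℝ F'] [FiniteDimensional ℝ F']
  {K' : Type*} [TopologicalSpace K'] [ChartedSpace F' K'] [Group K'] [LieGroup 𝓘(ℝ, F') ∞ K']
  {m : ℕ} {X : (g : G) → TangentSpace 𝓘(ℝ, E) g} {B : Fin m → GroupLieAlgebra 𝓘(ℝ, E) G}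

/-- The set of the points of `K` that are mapped into the reachable set is an open submonoid: for
`k` and `l` in this set, the integral curve through `f l` stays in the coset of `f l` modulo the
image of `K'`, which consists of reachable points, so that `f k * f l` is reachable. -/
lemma range_subset_reachableSet [ConnectedSpace G] [ConnectedSpace K] [ConnectedSpace K']
    (hX : IsLinearVectorField X) {Ω : Set (Fin m → ℝ)} {U : Set (ℝ → Fin m → ℝ)}
    (hU : IsControlClass Ω U) (hA : IsOpen (reachableSet X B U (1 : G)))
    {𝔥 𝔫 : LieSubalgebra ℝ (GroupLieAlgebra 𝓘(ℝ, E) G)} (h_le : 𝔫 ≤ 𝔥)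
    (h_ideal : ∀ x ∈ 𝔥, ∀ y ∈ 𝔫, ⁅x, y⁆ ∈ 𝔫) (hD : ∀ x ∈ 𝔥, assocDerivation X x ∈ 𝔫)
    {f : K →* G} (hf : ContMDiff 𝓘(ℝ, F) 𝓘(ℝ, E) ∞ f)
    (hfh : ∀ v : GroupLieAlgebra 𝓘(ℝ, F) K, homDeriv (E := E) f v ∈ 𝔥)
    {f' : K' →* G} (hf' : ContMDiff 𝓘(ℝ, F') 𝓘(ℝ, E) ∞ f')
    (hinj : Function.Injective (homDeriv (F := F') (E := E) f'))
    (hfn : ∀ v : GroupLieAlgebra 𝓘(ℝ, E) G, v ∈ 𝔫 ↔ ∃ w, homDeriv (F := F') (E := E) f' w = v)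
    (hA' : ∀ n, f' n ∈ reachableSet X B U 1) (k : K) : f k ∈ reachableSet X B U 1 := by
  have hmul_right : ∀ a ∈ reachableSet X B U (1 : G), ∀ n, a * f' n ∈ reachableSet X B U 1 := by
    intro a ha n
    refine mul_mem_reachableSet hX hU (fun T hT => ?_) ha
    have hmem : leftReading X (f' n) ∈ 𝔫 := leftReading_mem (𝔥 := 𝔫) hX hf'
      (fun v => (hfn _).2 ⟨v, rfl⟩) (fun x hx => h_ideal x (h_le hx)) (fun x hx => hD x (h_le hx)) n
    obtain ⟨x, hxT, hxc, hx⟩ :=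
      exists_integralCurve_coset hX hf' hinj hfn (fun x hx => hD x (h_le hx)) hmem hT
    refine ⟨x, hxT, ?_, hx⟩
    obtain ⟨n', hn'⟩ := hxc 0
    rw [hn', ← map_mul]
    exact hA' _
  have : IsTopologicalGroup K := topologicalGroup_of_lieGroup 𝓘(ℝ, F) ∞
  refine mem_of_isOpen_of_mul_mem (S := f ⁻¹' reachableSet X B U 1) (hA.preimage hf.continuous)
    ?_ (fun k hk l hl => ?_) k
  · simpa using hA' 1
  · rw [mem_preimage, map_mul]
    refine mul_mem_reachableSet hX hU (fun T hT => ?_) hk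
    obtain ⟨x, hxT, hxc, hx⟩ := exists_integralCurve_coset hX hf' hinj hfn
      (fun x hx => hD x (h_le hx)) (leftReading_mem hX hf hfh h_ideal hD l) hT
    refine ⟨x, hxT, ?_, hx⟩
    obtain ⟨n, hn⟩ := hxc 0
    rw [hn]
    exact hmul_right _ hl n

end Reachability

end LieControl

end

theorem proposition3p5
    {E : Type*} [NormedAddCommGroup E] [NormedSpace ℝ E] [FiniteDimensional ℝ E]
    {G : Type*} [TopologicalSpace G] [ChartedSpace E G] [Group G]
    [LieGroup 𝓘(ℝ, E) ∞ G] [T2Space G] [ConnectedSpace G]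
    -- the control range, the controls and the linear system
    {m : ℕ} (Ω : Set (Fin m → ℝ)) (hΩ : (0 : Fin m → ℝ) ∈ interior Ω)
    (U : Set (ℝ → Fin m → ℝ)) (hU : LieControl.IsControlClass Ω U)
    (X : (g : G) → TangentSpace 𝓘(ℝ, E) g) (hX : LieControl.IsLinearVectorField X)
    (B : Fin m → GroupLieAlgebra 𝓘(ℝ, E) G)
    (hA : IsOpen (LieControl.reachableSet X B U (1 : G)))
    -- the subalgebra, its ideal and the corresponding connected Lie subgroups
    (𝔥 𝔫 : LieSubalgebra ℝ (GroupLieAlgebra 𝓘(ℝ, E) G)) (h_le : 𝔫 ≤ 𝔥)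
    (h_ideal : ∀ x ∈ 𝔥, ∀ y ∈ 𝔫, ⁅x, y⁆ ∈ 𝔫)
    (hD : ∀ x ∈ 𝔥, LieControl.assocDerivation X x ∈ 𝔫)
    (H N : Subgroup G)
    (hH : LieControl.IsConnectedLieSubgroup 𝔥.toSubmodule H)
    (hN : LieControl.IsConnectedLieSubgroup 𝔫.toSubmodule N)
    (hNA : (N : Set G) ⊆ LieControl.reachableSet X B U 1) :
    (H : Set G) ⊆ LieControl.reachableSet X B U 1 := by
  obtain ⟨k, topH, chartH, lieH, connH, hf, -, hrange⟩ := hH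
  obtain ⟨l, topN, chartN, lieN, connN, hf', hinj, hrange'⟩ := hN
  intro h hh
  refine LieControl.range_subset_reachableSet (K := H) (K' := N) hX hU hA h_le h_ideal hD
    (f := H.subtype) hf (fun v => (hrange _).2 ⟨v, rfl⟩) (f' := N.subtype) hf' (hinj 1) hrange'
    (fun n => hNA n.2) ⟨h, hh⟩
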